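/- Let $n\in\mathbb N$, let $(U,\rho)$ be a separable metric space which is a Suslin space (that is, empty or a continuous image of a Polish space; this holds in particular if $U$ is complete), let $y_0\in\mathbb R^n$, and consider the controlled system $$y'(t)=G(t,|y(t)|)\frac{y(t)}{|y(t)|}+A(t)y(t)+b(t,u(t)),\quad t>0,\qquad y(0)=y_0,$$ where the first term on the right is read as $0$ when $y(t)=0$. Measurability in $t$ is Lebesgue measurability. Assume: 1. $G:[0,\infty)^2\to\mathbb R$ is such that $G(t,r)$ is measurable in $t$, continuously differentiable in $r\in[0,\infty)$, $G(t,0)=0$ for all $t\ge 0$, and $\sup_{(t,r)\in[0,M]^2}\left|\frac{\partial G}{\partial r}(t,r)\right|<\infty$ for every $M>0$. 2. $A:[0,\infty)\to\mathbb R^{n\times n}$ is measurable and $\sup_{t\in[0,T]}\|A(t)\|<\infty$ for every $T>0$, where $\|\cdot\|$ is the operator norm for the Euclidean norm. 3. $b:[0,\infty)\times U\to\mathbb R^n$ is measurable in the first and continuous in the second variable, and $\{b(t,u): u\in U\}$ is convex and compact for every $t\ge 0$. 4. There are $R_0>0$ and a measurable function $\zeta:[R_0,\infty)\to[0,\infty)$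 with $$G(t,r)-\|A(t)\|\,r-\sup_{u\in U}|b(t,u)|\ \ge\ \zeta(r)\quad\text{for all }t\ge 0,\ r\ge R_0,\qquad \int_{R_0}^{\infty}\frac{dr}{\zeta(r)}<\infty ,$$ with the convention $1/0=\infty$. Let $\mathcal U$ be the set of measurable functions $u:[0,\infty)\to U$. Let $\mathcal P_{ad}$ be the set of triples $(T,y,u)$ with $T\in(0,\infty)$, $u\in\mathcal U$ and $y\in C([0,T);\mathbb R^n)$ such that $$y(t)=y_0+\int_0^t\Big(G(s,|y(s)|)\frac{y(s)}{|y(s)|}+A(s)y(s)+b(s,u(s))\Big)\,ds\quad\text{for all }t\in(0,T),\qquad \lim_{t\to T^-}|y(t)|=+\infty .$$ Assume that every control leads to blowup, i.e. for every $u\in\mathcal U$ there are $T$ and $y$ with $(T,y,u)\in\mathcal P_{ad}$, and that $$t^*=\sup_{(T,y,u)\in\mathcal P_{ad}}T$$ is finite (in particular $\mathcal P_{ad}\neq\emptyset$). Then the maximal blowup time problem has an optimal triple: there are $y^*$ and $u^*$ with $(t^*,y^*,u^*)\in\mathcal P_{ad}$. -/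

import Mathlib

open MeasureTheory Set Filter Topology

noncomputable section

namespace BlowupControl

/-- The data of the controlled system
`y'(t) = G(t, |y|) y / |y| + A(t) y + b(t, u)`, `y(0) = y₀` in `ℝⁿ`.
Only the values of `G`, `A`, `b` at times `t ≥ 0` (and of `G` at radii `r ≥ 0`) are ever used. -/
structure ControlSystem (n : ℕ) (U : Type*) where
  G : ℝ → ℝ → ℝ
  A : ℝ → Matrix (Fin n) (Fin n) ℝ
  b : ℝ → U → EuclideanSpace ℝ (Fin n)
  y₀ : EuclideanSpace ℝ (Fin n)

namespace ControlSystem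

variable {n : ℕ} {U : Type*} (S : ControlSystem n U)

/-- The matrix `A(t)` as an operator of Euclidean space; its norm is `sup_{|x| = 1} |A(t) x|`. -/
def opA (t : ℝ) : EuclideanSpace ℝ (Fin n) →L[ℝ] EuclideanSpace ℝ (Fin n) :=
  Matrix.toEuclideanCLM (n := Fin n) (𝕜 := ℝ) (S.A t)

/-- The right-hand side; the first term is `0` at `y = 0`. -/
def f (t : ℝ) (y : EuclideanSpace ℝ (Fin n)) (u : U) : EuclideanSpace ℝ (Fin n) :=
  S.G t ‖y‖ • (‖y‖⁻¹ • y) + S.opA t y + S.b t u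

/-- `G` is (Lebesgue) measurable in `t`, continuously differentiable in `r ∈ [0, ∞)`,
vanishes at `r = 0`, and `∂G/∂r` is bounded on every square `[0, M]²`. -/
structure P2 : Prop where
  measurable : ∀ r, 0 ≤ r → AEMeasurable (fun t => S.G t r) (volume.restrict (Ici 0))
  contDiff : ∀ t, 0 ≤ t → ContDiffOn ℝ 1 (S.G t) (Ici 0)
  zero : ∀ t, 0 ≤ t → S.G t 0 = 0
  deriv_bounded : ∀ M, 0 < M → ∃ C, ∀ t ∈ Icc 0 M, ∀ r ∈ Icc 0 M,
    |derivWithin (S.G t) (Ici 0) r| ≤ C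

/-- `A` is measurable and bounded on bounded time intervals. -/
structure P3 : Prop where
  measurable : ∀ i j, AEMeasurable (fun t => S.A t i j) (volume.restrict (Ici 0))
  bounded : ∀ T, 0 < T → ∃ C, ∀ t ∈ Icc 0 T, ‖S.opA t‖ ≤ C

/-- `b` is a Carathéodory function and every set `b(t, U)` is convex and compact. -/
structure P4 [TopologicalSpace U] : Prop where
  measurable : ∀ u, AEMeasurable (fun t => S.b t u) (volume.restrict (Ici 0))
  continuous : ∀ t, 0 ≤ t → Continuous (S.b t)
  convex : ∀ t, 0 ≤ t → Convex ℝ (range (S.b t))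
  compact : ∀ t, 0 ≤ t → IsCompact (range (S.b t))

/-- `G(t, r) - ‖A(t)‖ r - sup_u |b(t, u)| ≥ ζ(r)` for all `t ≥ 0`, `r ≥ R₀`, for some
nonnegative (measurable) `ζ` with `∫_{R₀}^∞ dr / ζ(r) < ∞`, where `1 / 0 = ∞`. -/
def P5 : Prop :=
  ∃ R₀ : ℝ, 0 < R₀ ∧ ∃ ζ : ℝ → ℝ,
    AEMeasurable ζ (volume.restrict (Ici R₀)) ∧
    (∀ r, R₀ ≤ r → 0 ≤ ζ r) ∧
    (∀ t, 0 ≤ t → ∀ r, R₀ ≤ r → ζ r ≤ S.G t r - ‖S.opA t‖ * r - ⨆ u : U, ‖S.b t u‖) ∧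
    ∫⁻ r in Ici R₀, (ENNReal.ofReal (ζ r))⁻¹ < ⊤

/-- `y` is continuous on `[0, T)` and solves the integral equation of the system there. -/
def IsSolutionOn (T : ℝ) (y : ℝ → EuclideanSpace ℝ (Fin n)) (u : ℝ → U) : Prop :=
  ContinuousOn y (Ico 0 T) ∧ ∀ t ∈ Ioo 0 T,
    IntervalIntegrable (fun s => S.f s (y s) (u s)) volume 0 t ∧
    y t = S.y₀ + ∫ s in (0 : ℝ)..t, S.f s (y s) (u s)

/-- All (Lebesgue) measurable controls on `[0, ∞)` with values in `U`. -/
def controls (U : Type*) [MeasurableSpace U] : Set (ℝ → U) :=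
  {u | AEMeasurable u (volume.restrict (Ici 0))}

variable [MeasurableSpace U]

/-- The feasible triples `(T, y, u)`. -/
def feasible : Set (ℝ × (ℝ → EuclideanSpace ℝ (Fin n)) × (ℝ → U)) :=
  {p | 0 < p.1 ∧ p.2.2 ∈ controls U ∧ S.IsSolutionOn p.1 p.2.1 p.2.2}

/-- The admissible triples: those with `|y(t)| → ∞` as `t ↑ T`. -/
def admissible : Set (ℝ × (ℝ → EuclideanSpace ℝ (Fin n)) × (ℝ → U)) :=
  {p | p ∈ S.feasible ∧ Tendsto (fun t => ‖p.2.1 t‖) (𝓝[<] p.1) atTop}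

/-- The admissible controls. -/
def admissibleControls : Set (ℝ → U) :=
  {u | u ∈ controls U ∧ ∃ T y, (T, y, u) ∈ S.admissible}

/-- The set of all blowup times. -/
def blowupTimes : Set ℝ := {T | ∃ y u, (T, y, u) ∈ S.admissible}

/-- `p` is an optimal triple of the maximal blowup time problem. -/
def IsOptimalTS (p : ℝ × (ℝ → EuclideanSpace ℝ (Fin n)) × (ℝ → U)) : Prop :=
  p ∈ S.admissible ∧ IsLUB S.blowupTimes p.1

end ControlSystem

end BlowupControl

end

/-!
The blowup time is at most `tstar`, so a maximizing sequence of triples has blowup times `T k` with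
`T k → tstar`. The growth condition says that outside the ball of radius `R₀` the radius `‖y‖`
increases at least with speed `ζ(‖y‖)`, and from radius `R` it reaches infinity within the time
`∫_R^∞ dr / ζ`. Hence a solution that is very large at a time `t` blows up soon after `t`, and
solutions whose existence time is close to `tstar` are bounded on each `[0, τ]`, `τ < tstar`,
uniformly in the control (`exists_apriori_bound`). As `ζ` is only measurable and may vanish
somewhere, it is first replaced by a continuous positive function (`exists_continuous_growth`);
the comparison then needs only Dini derivatives (`sub_le_integral_inv_of_growth`).

The growth condition at the single radius `R₀` also bounds `b`, so the solutions are equi-Lipschitz,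
and a subsequence converges pointwise on `[0, tstar)` (`exists_subseq_tendsto_of_lipschitz`). What
the controls contribute to the limit is a Lipschitz curve `w`. Its increments satisfy
`⟪e, w t - w s⟫ ≤ ∫ sup_u ⟪e, b(·, u)⟫` over `[s, t]` for every direction `e`; differentiating,
`w'(t)` satisfies the inequalities of the support function of `b(t, U)`, so it belongs to this
convex compact set for almost every `t`. Filippov's lemma (`exists_measurable_implicit`) provides a
measurable control `v` with `w'(t) = b(t, v(t))`, and the limit is a solution for `v` on
`[0, tstar)` (`exists_isSolutionOn_of_tendsto`). Measurability of the selection is elementary: on a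
compact subset of the Baire space the zero that is least for a continuous injection into `ℝ` depends
measurably on the parameter, and compact subsets suffice up to small measure because outer measure
is continuous along increasing unions (`exists_isCompact_le_measure_zeros`).

By hypothesis `v` leads to blowup at some time, which is at most `tstar`. By uniqueness the solution
that blows up is the limit solution, which is locally bounded on `[0, tstar)`; so the blowup time
is `tstar`.
-/

namespace BlowupControl

/-! ### Measurable selection -/

section Selection

variable {Ω X : Type*} {h : Ω → X → ℝ}

/-- The parameters `t` at which the infimum of `h t` over `A` is at most `0`. Unlike the set of
those `t` at which `h t` has a zero in `A`, it is measurable for every `A`. -/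
def approxZeros (h : Ω → X → ℝ) (A : Set X) : Set Ω :=
  {t | ∀ j : ℕ, ∃ x ∈ A, h t x < 1 / (j + 1)}

lemma approxZeros_mono {A B : Set X} (hAB : A ⊆ B) : approxZeros h A ⊆ approxZeros h B :=
  fun _ ht j => (ht j).imp fun _ hx => ⟨hAB hx.1, hx.2⟩

lemma measurableSet_approxZeros [MeasurableSpace Ω] [TopologicalSpace X]
    [TopologicalSpace.PseudoMetrizableSpace X] [SecondCountableTopology X]
    (hm : ∀ x, Measurable fun t => h t x)
    (hc : ∀ t, Continuous (h t)) (A : Set X) : MeasurableSet (approxZeros h A) := by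
  obtain ⟨D, hDA, hDc, hD⟩ := (TopologicalSpace.IsSeparable.of_separableSpace A
    ).exists_countable_dense_subset
  have key : approxZeros h A = ⋂ j : ℕ, ⋃ d ∈ D, {t | h t d < 1 / ((j : ℝ) + 1)} := by
    ext t
    simp only [approxZeros, mem_ofPred_eq, mem_iInter, mem_iUnion, exists_prop]
    refine forall_congr' fun j => ⟨?_, fun ⟨d, hd, h1⟩ => ⟨d, hDA hd, h1⟩⟩
    rintro ⟨x, hxA, hx⟩
    obtain ⟨d, hd1, hd2⟩ := mem_closure_iff.1 (hD hxA) _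
      (isOpen_Iio.preimage (hc t) : IsOpen (h t ⁻¹' Iio (1 / ((j : ℝ) + 1)))) hx
    exact ⟨d, hd2, hd1⟩
  rw [key]
  exact .iInter fun j => .biUnion hDc fun d _ => measurableSet_lt (hm d) measurable_const

lemma approxZeros_eq_of_isCompact [TopologicalSpace X] [FirstCountableTopology X]
    (h0 : ∀ t x, 0 ≤ h t x)
    (hc : ∀ t, Continuous (h t)) {K : Set X} (hK : IsCompact K) :
    approxZeros h K = {t | ∃ x ∈ K, h t x = 0} := by
  ext t
  refine ⟨fun ht => ?_, fun ⟨x, hxK, hx⟩ j => ⟨x, hxK, by rw [hx]; positivity⟩⟩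
  choose x hxK hx using ht
  obtain ⟨a, haK, φ, hφ, hlim⟩ := hK.tendsto_subseq hxK
  refine ⟨a, haK, le_antisymm ?_ (h0 t a)⟩
  exact le_of_tendsto_of_tendsto (((hc t).tendsto a).comp hlim)
    (tendsto_one_div_add_atTop_nhds_zero_nat.comp hφ.tendsto_atTop)
    (Eventually.of_forall fun j => (hx (φ j)).le)

variable [MeasurableSpace Ω]

/-- A continuous injection of the Baire space into the line: a sequence is coded by the
characteristic function of its graph, and the Cantor space embeds into `ℝ`. -/
lemma exists_continuous_injective_baire :
    ∃ c : (ℕ → ℕ) → ℝ, Continuous c ∧ Function.Injective c := by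
  obtain ⟨f, -, hf, hfi⟩ := (isClosed_univ (X := ℝ)).exists_nat_bool_injection_of_not_countable
    Cardinal.not_countable_real
  refine ⟨fun x => f fun k => decide (x k.unpair.1 = k.unpair.2), hf.comp ?_, fun x y hxy => ?_⟩
  · refine continuous_pi fun k => ?_
    exact (continuous_of_discreteTopology (f := fun m : ℕ => decide (m = k.unpair.2))).comp
      (continuous_apply k.unpair.1)
  · ext i
    have := congrFun (hfi hxy) (Nat.pair i (x i))
    simp only [Nat.unpair_pair, decide_true] at this
    exact (of_decide_eq_true this.symm).symm

/-- A measurable selection of zeros in a compact set: choose the zero which is least for a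
continuous injection into the line. -/
lemma exists_measurable_zero_of_isCompact {h : Ω → (ℕ → ℕ) → ℝ}
    (hm : ∀ x, Measurable fun t => h t x) (hc : ∀ t, Continuous (h t)) (h0 : ∀ t x, 0 ≤ h t x)
    {K : Set (ℕ → ℕ)} (hK : IsCompact K) :
    ∃ u : Ω → ℕ → ℕ, Measurable u ∧ ∀ t, (∃ x ∈ K, h t x = 0) → h t (u t) = 0 := by
  obtain ⟨c, hcc, hci⟩ := exists_continuous_injective_baire
  have hmeas : ∀ K : Set (ℕ → ℕ), IsCompact K → MeasurableSet {t | ∃ x ∈ K, h t x = 0} :=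
    fun K hK => approxZeros_eq_of_isCompact h0 hc hK ▸ measurableSet_approxZeros hm hc K
  have hex : ∀ t, ∃ x, (∃ x ∈ K, h t x = 0) →
      (x ∈ K ∧ h t x = 0) ∧ ∀ y ∈ K, h t y = 0 → c x ≤ c y := by
    intro t
    by_cases ht : ∃ x ∈ K, h t x = 0
    · have hcomp : IsCompact (K ∩ h t ⁻¹' {0}) :=
        hK.inter_right ((isClosed_singleton).preimage (hc t))
      obtain ⟨x, hx, hmin⟩ := hcomp.exists_isMinOn ht hcc.continuousOn
      exact ⟨x, fun _ => ⟨hx, fun y hy h1 => hmin ⟨hy, h1⟩⟩⟩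
    · exact ⟨fun _ => 0, fun h => absurd h ht⟩
  choose v hv using hex
  classical
  have hE := hmeas K hK
  refine ⟨fun t => if t ∈ {t | ∃ x ∈ K, h t x = 0} then v t else fun _ => 0, ?_, ?_⟩
  · rw [← (hcc.measurableEmbedding hci).measurable_comp_iff]
    refine measurable_of_Iic fun a => ?_
    have : (c ∘ fun t => if t ∈ {t | ∃ x ∈ K, h t x = 0} then v t else fun _ => 0) ⁻¹' Iic a =
        {t | ∃ x ∈ K ∩ c ⁻¹' Iic a, h t x = 0} ∪
          ({t | ∃ x ∈ K, h t x = 0}ᶜ ∩ {_t | c (fun _ => 0) ≤ a}) := by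
      ext t
      by_cases ht : ∃ x ∈ K, h t x = 0
      · simp only [mem_preimage, Function.comp_apply, mem_ofPred_eq, ht, if_true, mem_Iic,
          mem_union, mem_inter_iff, mem_compl_iff, not_true, false_and, or_false]
        obtain ⟨⟨h1, h2⟩, h3⟩ := hv t ht
        exact ⟨fun h => ⟨_, ⟨h1, h⟩, h2⟩, fun ⟨x, ⟨hx, hxa⟩, hx0⟩ => (h3 x hx hx0).trans hxa⟩
      · simp only [mem_preimage, Function.comp_apply, mem_ofPred_eq, ht, if_false, mem_Iic,
          mem_union, mem_inter_iff, mem_compl_iff, not_false_eq_true, true_and]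
        exact ⟨Or.inr, fun h => h.resolve_left fun ⟨x, hx, hx0⟩ => ht ⟨x, hx.1, hx0⟩⟩
    rw [this]
    exact (hmeas _ (hK.inter_right (isClosed_Iic.preimage hcc))).union
      (hE.compl.inter (MeasurableSet.const _))
  · intro t ht
    simp only [mem_ofPred_eq, ht, if_true]
    exact (hv t ht).1.2

/-- If `h t` has a zero for almost every `t`, then zeros can be found in a single compact set up to
a set of small measure. The bounds `N i` on the coordinates are chosen one after the other; the sets
involved need not be measurable, but outer measure is continuous along increasing unions. -/
lemma exists_isCompact_le_measure_zeros {h : Ω → (ℕ → ℕ) → ℝ} {μ : Measure Ω} [IsFiniteMeasure μ]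
    (hm : ∀ x, Measurable fun t => h t x) (hc : ∀ t, Continuous (h t)) (h0 : ∀ t x, 0 ≤ h t x)
    (hz : ∀ᵐ t ∂μ, ∃ x, h t x = 0) {c : ENNReal} (hcμ : c < μ univ) :
    ∃ K : Set (ℕ → ℕ), IsCompact K ∧ c ≤ μ {t | ∃ x ∈ K, h t x = 0} := by
  let B : (ℕ → ℕ) → ℕ → Set (ℕ → ℕ) := fun N k => {x | ∀ i < k, x i ≤ N i}
  let W : Set (ℕ → ℕ) → Set Ω := fun A => {t | ∃ x ∈ A, h t x = 0}
  have hW0 : c < μ (W (B 0 0)) := by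
    refine hcμ.trans_eq (measure_congr ?_).symm
    rw [eventuallyEq_univ]
    filter_upwards [hz] with t ⟨x, hx⟩
    exact ⟨x, by simp [B], hx⟩
  have step : ∀ N k, c < μ (W (B N k)) → ∃ m, c < μ (W (B (Function.update N k m) (k + 1))) := by
    intro N k hN
    have hmono : Monotone fun m => W (B (Function.update N k m) (k + 1)) := by
      intro m m' hmm t ⟨x, hx, hx0⟩
      refine ⟨x, fun i hi => (hx i hi).trans ?_, hx0⟩
      rcases eq_or_ne i k with rfl | hik
      · simpa using hmm
      · simp [hik]
    have hun : W (B N k) = ⋃ m, W (B (Function.update N k m) (k + 1)) := by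
      ext t
      simp only [mem_iUnion]
      constructor
      · rintro ⟨x, hx, hx0⟩
        refine ⟨x k, x, fun i hi => ?_, hx0⟩
        rcases eq_or_ne i k with rfl | hik
        · simp
        · simpa [hik] using hx i (by omega)
      · rintro ⟨m, x, hx, hx0⟩
        refine ⟨x, fun i hi => ?_, hx0⟩
        simpa [hi.ne] using hx i (by omega)
    rw [hun, hmono.measure_iUnion] at hN
    exact lt_iSup_iff.1 hN
  choose m hm' using step
  let F : (k : ℕ) → {N : ℕ → ℕ // c < μ (W (B N k))} := fun k =>
    Nat.rec ⟨0, hW0⟩ (fun k N => ⟨Function.update N.1 k (m N.1 k N.2), hm' N.1 k N.2⟩) k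
  have hF : ∀ k, (F (k + 1)).1 = Function.update (F k).1 k (m (F k).1 k (F k).2) := fun k => rfl
  let N : ℕ → ℕ := fun i => (F (i + 1)).1 i
  have hFN : ∀ k, ∀ i < k, (F k).1 i = N i := by
    intro k
    induction k with
    | zero => intro i hi; omega
    | succ k ih =>
      intro i hi
      rcases eq_or_ne i k with rfl | hik
      · rfl
      · rw [hF, Function.update_of_ne hik, ih i (by omega)]
  have hBN : ∀ k, B (F k).1 k = B N k := fun k => by
    ext x
    exact forall₂_congr fun i hi => by rw [hFN k i hi]
  have hK : IsCompact {x : ℕ → ℕ | ∀ i, x i ∈ Iic (N i)} :=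
    isCompact_pi_infinite fun i => (finite_Iic _).isCompact
  refine ⟨_, hK, ?_⟩
  have hsub : ⋂ k, approxZeros h (B N k) ⊆ W {x | ∀ i, x i ∈ Iic (N i)} := by
    intro t ht
    change t ∈ {t | ∃ x ∈ {x : ℕ → ℕ | ∀ i, x i ∈ Iic (N i)}, h t x = 0}
    have hx : ∀ k : ℕ, ∃ x ∈ B N k, h t x < 1 / (k + 1) := fun k => mem_iInter.1 ht k k
    choose x hxB hx using hx
    -- truncating the approximate zeros puts them into the compact set and changes only
    -- coordinates of large index
    obtain ⟨a, haK, φ, hφ, hlim⟩ := hK.tendsto_subseq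
      (x := fun k i => min (x k i) (N i)) (fun k i => min_le_right (x k i) (N i))
    refine ⟨a, haK, le_antisymm ?_ (h0 t a)⟩
    have hlim' : Tendsto (x ∘ φ) atTop (𝓝 a) := by
      rw [tendsto_pi_nhds] at hlim ⊢
      intro i
      refine (hlim i).congr' ?_
      filter_upwards [hφ.tendsto_atTop.eventually_gt_atTop i] with k hk
      exact min_eq_left (hxB (φ k) i hk)
    exact le_of_tendsto_of_tendsto (((hc t).tendsto a).comp hlim')
      (tendsto_one_div_add_atTop_nhds_zero_nat.comp hφ.tendsto_atTop)
      (Eventually.of_forall fun j => (hx (φ j)).le)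
  refine le_trans ?_ (measure_mono hsub)
  have hanti : Antitone fun k => approxZeros h (B N k) := fun k l hkl =>
    approxZeros_mono fun x hx i hi => hx i (hi.trans_le hkl)
  rw [hanti.measure_iInter (fun k => (measurableSet_approxZeros hm hc _).nullMeasurableSet)
    ⟨0, measure_ne_top _ _⟩]
  refine le_iInf fun k => (F k).2.le.trans (measure_mono ?_)
  rintro t ⟨x, hx, hx0⟩ j
  exact ⟨x, hBN k ▸ hx, by rw [hx0]; positivity⟩

/-- Measurable selection of zeros over the Baire space. -/
lemma exists_measurable_zero {h : Ω → (ℕ → ℕ) → ℝ} {μ : Measure Ω} [IsFiniteMeasure μ]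
    (hm : ∀ x, Measurable fun t => h t x) (hc : ∀ t, Continuous (h t)) (h0 : ∀ t x, 0 ≤ h t x)
    (hz : ∀ᵐ t ∂μ, ∃ x, h t x = 0) :
    ∃ u : Ω → ℕ → ℕ, Measurable u ∧ ∀ᵐ t ∂μ, h t (u t) = 0 := by
  rcases eq_or_ne (μ univ) 0 with hμ | hμ
  · exact ⟨fun _ _ => 0, measurable_const, by simp [Measure.measure_univ_eq_zero.1 hμ]⟩
  obtain ⟨c, -, hclt, hclim⟩ := exists_seq_strictMono_tendsto' (pos_iff_ne_zero.2 hμ)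
  choose K hK hKc using fun j =>
    exists_isCompact_le_measure_zeros hm hc h0 hz (hclt j).2
  choose v hv hv0 using fun j => exists_measurable_zero_of_isCompact hm hc h0 (hK j)
  have hE : ∀ j, MeasurableSet {t | h t (v j t) = 0} := by
    intro j
    have := measurable_uncurry_of_continuous_of_measurable (u := fun x t => h t x)
      (fun t => hc t) hm
    exact (this.comp ((hv j).prodMk measurable_id)) (measurableSet_singleton 0)
  have hcover : ∀ᵐ t ∂μ, ∃ j, h t (v j t) = 0 := by
    have hU : MeasurableSet (⋃ j, {t | h t (v j t) = 0}) := .iUnion hE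
    have : μ (⋃ j, {t | h t (v j t) = 0}) = μ univ := by
      refine le_antisymm (measure_mono (subset_univ _)) (le_of_tendsto' hclim fun j => ?_)
      refine (hKc j).trans (measure_mono fun t ht => mem_iUnion.2 ⟨j, hv0 j t ht⟩)
    have h1 := (ae_eq_univ_iff_measure_eq hU.nullMeasurableSet).2 this
    filter_upwards [eventuallyEq_univ.1 h1] with t ht
    simpa using ht
  classical
  have hmeas := Measurable.find (f := v)
    (p := fun j t => h t (v j t) = 0 ∨ t ∉ ⋃ j, {t | h t (v j t) = 0}) hv
    (fun j => (hE j).union (MeasurableSet.iUnion hE).compl) (fun t => by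
      by_cases ht : t ∈ ⋃ j, {t | h t (v j t) = 0}
      · obtain ⟨j, hj⟩ := mem_iUnion.1 ht
        exact ⟨j, Or.inl hj⟩
      · exact ⟨0, Or.inr ht⟩)
  refine ⟨_, hmeas, ?_⟩
  filter_upwards [hcover] with t ht
  generalize_proofs hp
  exact (Nat.find_spec hp).resolve_right fun h1 => h1 (mem_iUnion.2 ht)

end Selection

/-! ### Carathéodory functions -/

section Caratheodory

variable {Ω X E : Type*} [MeasurableSpace Ω] [TopologicalSpace X]
  [TopologicalSpace.MetrizableSpace X] [SecondCountableTopology X]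
  [TopologicalSpace E] [TopologicalSpace.MetrizableSpace E] [MeasurableSpace E] [BorelSpace E]
  {μ : Measure Ω}

/-- A Carathéodory function coincides, in all points `x` at once, with a Carathéodory function all
of whose sections in `t` are measurable, except for a null set of parameters `t`. -/
lemma exists_measurable_caratheodory [Nonempty E] {h : Ω → X → E}
    (hm : ∀ x, AEMeasurable (fun t => h t x) μ) (hc : ∀ᵐ t ∂μ, Continuous (h t)) :
    ∃ g : Ω → X → E, (∀ x, Measurable fun t => g t x) ∧ (∀ t, Continuous (g t)) ∧
      ∀ᵐ t ∂μ, h t = g t := by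
  classical
  obtain ⟨e⟩ := ‹Nonempty E›
  obtain ⟨D, hDc, hD⟩ := TopologicalSpace.exists_countable_dense X
  have hgood : ∀ᵐ t ∂μ, Continuous (h t) ∧ ∀ d ∈ D, h t d = (hm d).mk _ t :=
    hc.and ((ae_ball_iff hDc).2 fun d _ => (hm d).ae_eq_mk)
  obtain ⟨N, hN, hNm, hN0⟩ := exists_measurable_superset_of_null (ae_iff.1 hgood)
  have hout : ∀ t ∉ N, Continuous (h t) ∧ ∀ d ∈ D, h t d = (hm d).mk _ t := by
    intro t ht
    by_contra hcon
    exact ht (hN hcon)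
  let g : Ω → X → E := fun t x => if t ∈ N then e else h t x
  have hgc : ∀ t, Continuous (g t) := by
    intro t
    by_cases ht : t ∈ N
    · simpa [g, ht] using continuous_const
    · simpa [g, ht] using (hout t ht).1
  have hgD : ∀ d ∈ D, Measurable fun t => g t d := by
    intro d hd
    have : (fun t => g t d) = fun t => if t ∈ N then e else (hm d).mk _ t := by
      funext t
      by_cases ht : t ∈ N
      · simp [g, ht]
      · simpa [g, ht] using (hout t ht).2 d hd
    rw [this]
    exact Measurable.ite hNm measurable_const (hm d).measurable_mk
  refine ⟨g, fun x => ?_, hgc, ?_⟩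
  · obtain ⟨d, hd, hlim⟩ := mem_closure_iff_seq_limit.1 (hD x)
    exact measurable_of_tendsto_metrizable (fun k => hgD (d k) (hd k))
      (tendsto_pi_nhds.2 fun t => ((hgc t).tendsto x).comp hlim)
  · filter_upwards [measure_eq_zero_iff_ae_notMem.1 hN0] with t ht
    simp [g, ht]

/-- Superposition of a Carathéodory function with a measurable function is measurable. -/
lemma aemeasurable_superposition [MeasurableSpace X] [OpensMeasurableSpace X] [Nonempty E]
    {h : Ω → X → E} {u : Ω → X}
    (hm : ∀ x, AEMeasurable (fun t => h t x) μ) (hc : ∀ᵐ t ∂μ, Continuous (h t))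
    (hu : AEMeasurable u μ) : AEMeasurable (fun t => h t (u t)) μ := by
  obtain ⟨g, hgm, hgc, hgh⟩ := exists_measurable_caratheodory hm hc
  have hg := measurable_uncurry_of_continuous_of_measurable (u := fun x t => g t x) hgc hgm
  refine (hg.comp_aemeasurable (hu.prodMk aemeasurable_id)).congr ?_
  filter_upwards [hgh] with t ht
  simp [ht]

end Caratheodory

/-- Filippov's lemma: a measurable function with `v t ∈ h t '' U`, where `U` is a Suslin space and
`h` is a Carathéodory function, is of the form `v t = h t (u t)` with `u` measurable. -/
lemma exists_measurable_implicit {Ω U E : Type*} [MeasurableSpace Ω] {μ : Measure Ω}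
    [IsFiniteMeasure μ] [MetricSpace U] [TopologicalSpace.SeparableSpace U] [MeasurableSpace U]
    [BorelSpace U] (hU : AnalyticSet (univ : Set U)) [NormedAddCommGroup E] [MeasurableSpace E]
    [SecondCountableTopology E] [BorelSpace E] {h : Ω → U → E} {v : Ω → E}
    (hm : ∀ x, AEMeasurable (fun t => h t x) μ)
    (hc : ∀ᵐ t ∂μ, Continuous (h t)) (hv : AEMeasurable v μ) (hvh : ∀ᵐ t ∂μ, v t ∈ range (h t))
    [Nonempty U] : ∃ u : Ω → U, Measurable u ∧ ∀ᵐ t ∂μ, h t (u t) = v t := by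
  rw [AnalyticSet] at hU
  obtain ⟨φ, hφ, hφU⟩ := hU.resolve_left univ_nonempty.ne_empty
  have hsurj : Function.Surjective φ := range_eq_univ.1 hφU
  obtain ⟨g, hgm, hgc, hgh⟩ := exists_measurable_caratheodory hm hc
  obtain ⟨w, hw, hwz⟩ := exists_measurable_zero (μ := μ)
    (h := fun t x => ‖g t (φ x) - hv.mk v t‖) (fun x => ((hgm _).sub hv.measurable_mk).norm)
    (fun t => (((hgc t).comp hφ).sub continuous_const).norm) (fun _ _ => norm_nonneg _) (by
      filter_upwards [hgh, hvh, hv.ae_eq_mk] with t h1 ⟨u, hu⟩ h3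
      obtain ⟨x, rfl⟩ := hsurj u
      exact ⟨x, by rw [← h1, hu, h3, sub_self, norm_zero]⟩)
  refine ⟨φ ∘ w, hφ.measurable.comp hw, ?_⟩
  filter_upwards [hgh, hwz, hv.ae_eq_mk] with t h1 h2 h3
  rw [h1, h3]
  exact sub_eq_zero.1 (norm_eq_zero.1 h2)

/-! ### Differential inequalities -/

/-- Grönwall's inequality in integral form, for zero initial value. -/
lemma eq_zero_of_le_mul_integral {r : ℝ → ℝ} {K τ : ℝ} (hr : ContinuousOn r (Icc 0 τ))
    (h0 : ∀ t ∈ Icc 0 τ, 0 ≤ r t) (hle : ∀ t ∈ Icc 0 τ, r t ≤ K * ∫ s in (0 : ℝ)..t, r s) :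
    ∀ t ∈ Icc 0 τ, r t = 0 := by
  intro t ht
  have hτ : 0 ≤ τ := ht.1.trans ht.2
  -- the primitive of an extension of `r` to the line
  let q : ℝ → ℝ := IccExtend hτ (domRestrict (Icc 0 τ) r)
  have hq : Continuous q := (continuousOn_iff_continuous_domRestrict.1 hr).Icc_extend'
  have hqr : ∀ s ∈ Icc 0 τ, q s = r s := fun s hs => by
    simp [q, IccExtend_of_mem _ _ hs, domRestrict]
  have hint : ∀ t ∈ Icc 0 τ, ∫ s in (0 : ℝ)..t, r s = ∫ s in (0 : ℝ)..t, q s := by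
    intro t ht
    refine intervalIntegral.integral_congr fun s hs => ?_
    rw [uIcc_of_le ht.1] at hs
    exact (hqr s ⟨hs.1, hs.2.trans ht.2⟩).symm
  have hder : ∀ t, HasDerivAt (fun t => ∫ s in (0 : ℝ)..t, q s) (q t) t := fun t =>
    intervalIntegral.integral_hasDerivAt_right (hq.intervalIntegrable _ _)
      (hq.stronglyMeasurableAtFilter _ _) hq.continuousAt
  have hnn : ∀ t ∈ Icc 0 τ, 0 ≤ ∫ s in (0 : ℝ)..t, q s := fun t ht =>
    intervalIntegral.integral_nonneg ht.1 fun s hs =>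
      (h0 s ⟨hs.1, hs.2.trans ht.2⟩).trans_eq (hqr s ⟨hs.1, hs.2.trans ht.2⟩).symm
  have hz := eq_zero_of_abs_deriv_le_mul_abs_self_of_eq_zero_right (K := K)
    (f := fun t => ∫ s in (0 : ℝ)..t, q s) (f' := q) (a := 0) (b := τ)
    (fun t _ => (hder t).continuousAt.continuousWithinAt) (fun t _ => (hder t).hasDerivWithinAt)
    (by simp) (fun t ht => by
      have ht' := Ico_subset_Icc_self ht
      rw [Real.norm_of_nonneg (hnn t ht'), hqr t ht', Real.norm_of_nonneg (h0 t ht'), ← hint t ht']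
      exact hle t ht') t ht
  refine le_antisymm ?_ (h0 t ht)
  have := hle t ht
  rwa [hint t ht, hz, mul_zero] at this

/-- If a continuous function starts above `R₀` and grows at `t` at least with the speed
`h (r t) > 0` as long as `R₀ ≤ r t`, then the time which it needs to grow from `r a` to `r b`
is at most `∫ 1 / h` over `[r a, r b]`. Only the lower right Dini derivative of `r` is used. -/
lemma sub_le_integral_inv_of_growth {r h : ℝ → ℝ} {a b R₀ : ℝ} (hab : a ≤ b)
    (hr : ContinuousOn r (Icc a b)) (hh : Continuous h) (hpos : ∀ x, 0 < h x) (ha : R₀ ≤ r a)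
    (hgrow : ∀ t ∈ Ico a b, R₀ ≤ r t → ∀ c < h (r t), ∀ᶠ s in 𝓝[>] t, c * (s - t) ≤ r s - r t) :
    r a ≤ r b ∧ b - a ≤ ∫ x in (r a)..(r b), (h x)⁻¹ := by
  have hmon : Icc a b ⊆ {s | r a ≤ r s} := by
    have hcl : IsClosed ({s | r a ≤ r s} ∩ Icc a b) := by
      rw [inter_comm]
      exact hr.preimage_isClosed_of_isClosed isClosed_Icc isClosed_Ici
    refine hcl.Icc_subset_of_forall_mem_nhdsWithin (le_refl (r a)) fun t ht => ?_
    have h1 : r a ≤ r t := ht.1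
    filter_upwards [hgrow t ht.2 (ha.trans h1) 0 (hpos _)] with s hs
    linarith
  refine ⟨hmon (right_mem_Icc.2 hab), ?_⟩
  have hinv : Continuous fun x => (h x)⁻¹ := hh.inv₀ fun x => (hpos x).ne'
  have hder : ∀ x, HasDerivAt (fun x => ∫ s in (r a)..x, (h s)⁻¹) (h x)⁻¹ x := fun x =>
    intervalIntegral.integral_hasDerivAt_right (hinv.intervalIntegrable _ _)
      (hinv.stronglyMeasurableAtFilter _ _) hinv.continuousAt
  set Φ : ℝ → ℝ := fun x => ∫ s in (r a)..x, (h s)⁻¹ with hΦ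
  have hΦmono : Monotone Φ := monotone_of_deriv_nonneg (fun x => (hder x).differentiableAt)
    fun x => by rw [(hder x).deriv]; exact (inv_pos.2 (hpos x)).le
  have hΦc : Continuous Φ := continuous_iff_continuousAt.2 fun x => (hder x).continuousAt
  have key := image_le_of_liminf_slope_right_le_deriv_boundary (f := fun t => - Φ (r t))
    (a := a) (b := b) (B := fun t => - (t - a)) (B' := fun _ => -1)
    (hΦc.comp_continuousOn hr).neg (by simp [Φ]) (by fun_prop)
    (fun x _ => ((hasDerivAt_id x).sub_const a).neg.hasDerivWithinAt) (fun t ht ρ hρ => by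
      apply Eventually.frequently
      have hRt : R₀ ≤ r t := ha.trans (hmon (Ico_subset_Icc_self ht))
      obtain ⟨c, hc1, hc2⟩ : ∃ c, -ρ * h (r t) < c ∧ c < h (r t) :=
        exists_between (by nlinarith [hpos (r t)])
      have hlin : HasDerivAt (fun s => Φ (r t + c * (s - t))) (c * (h (r t))⁻¹) t := by
        have h1 : HasDerivAt (fun s => r t + c * (s - t)) c t := by
          simpa using (((hasDerivAt_id t).sub_const t).const_mul c).const_add (r t)
        have h2 := HasDerivAt.comp t (by simpa using hder (r t)) h1
        rw [mul_comm]
        exact h2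
      have hslope := (hasDerivAt_iff_tendsto_slope.1 hlin).mono_left
        (nhdsWithin_mono t (fun s (hs : t < s) => hs.ne'))
      have hlt : -ρ < c * (h (r t))⁻¹ := by
        rw [← div_eq_mul_inv, lt_div_iff₀ (hpos _)]; exact hc1
      filter_upwards [hslope.eventually (lt_mem_nhds hlt), hgrow t ht hRt c hc2,
        self_mem_nhdsWithin] with s h1 h2 h3
      have h3' : 0 < s - t := sub_pos.2 h3
      have h4 : Φ (r t + c * (s - t)) ≤ Φ (r s) := hΦmono (by linarith)
      rw [slope_def_field] at h1 ⊢
      rw [lt_div_iff₀ h3'] at h1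
      rw [div_lt_iff₀ h3']
      simp only [sub_self, mul_zero, add_zero] at h1
      nlinarith)
  have := key (right_mem_Icc.2 hab)
  simp only [Φ] at this
  linarith

/-! ### Limits of integral curves of a differential inclusion -/

section Density

variable {E : Type*} [NormedAddCommGroup E] [InnerProductSpace ℝ E]

/-- A Lipschitz curve is the integral of a bounded function `v`, and bounds
`⟪e, w t - w s⟫ ≤ ∫ σ` on the increments of the curve are inherited by `v`. -/
lemma exists_integral_eq_of_lipschitzOnWith [FiniteDimensional ℝ E] [MeasurableSpace E]
    [BorelSpace E] {w : ℝ → E} {T : ℝ} {C : NNReal} (hT : 0 < T)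
    (hw : LipschitzOnWith C w (Ico 0 T)) (h0 : w 0 = 0) :
    ∃ v : ℝ → E, (∀ a b, IntervalIntegrable v volume a b) ∧ Measurable v ∧
      (∀ t ∈ Ico 0 T, w t = ∫ s in (0 : ℝ)..t, v s) ∧
      ∀ (e : E) (σ : ℝ → ℝ), IntervalIntegrable σ volume 0 T →
        (∀ s ∈ Ico 0 T, ∀ t ∈ Ico 0 T, s ≤ t → inner ℝ e (w t - w s) ≤ ∫ x in s..t, σ x) →
        ∀ᵐ t, t ∈ Ioo 0 T → inner ℝ e (v t) ≤ σ t := by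
  obtain ⟨g, hg, hgw⟩ := hw.extend_finite_dimension
  replace hgw := hgw.symm
  set L := lipschitzExtensionConstant E * C
  have hbd : ∀ t, ‖deriv g t‖ ≤ L := fun t => norm_deriv_le_of_lipschitz hg
  have hmeas : Measurable (deriv g) := measurable_deriv g
  have hint : ∀ a b, IntervalIntegrable (deriv g) volume a b := fun a b =>
    (intervalIntegrable_const (c := (L : ℝ))).mono_fun hmeas.aestronglyMeasurable
      (Eventually.of_forall fun t => (hbd t).trans (le_abs_self _))
  have hgd : ∀ᵐ t, DifferentiableAt ℝ g t := hg.ae_differentiableAt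
  have h0T : (0 : ℝ) ∈ Ico 0 T := ⟨le_rfl, hT⟩
  refine ⟨deriv g, hint, hmeas, fun t ht => ?_, fun e σ hσ hle => ?_⟩
  · have hlip : LipschitzWith L fun t => ∫ s in (0 : ℝ)..t, deriv g s := by
      refine LipschitzWith.of_dist_le_mul fun x y => ?_
      rw [dist_eq_norm, intervalIntegral.integral_interval_sub_left (hint _ _) (hint _ _),
        Real.dist_eq]
      exact intervalIntegral.norm_integral_le_of_norm_le_const fun s _ => hbd s
    obtain ⟨c, hc⟩ := ((hg.lipschitzOnWith (s := uIcc 0 t)).absolutelyContinuousOnInterval.sub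
      (hlip.lipschitzOnWith (s := uIcc 0 t)).absolutelyContinuousOnInterval
      ).const_of_ae_hasDerivAt_zero (by
        filter_upwards [hgd, (hint 0 t).ae_hasDerivAt_integral] with x h1 h2 hx
        simpa using h1.hasDerivAt.sub (h2 hx 0 left_mem_uIcc))
    have hc0 := hc 0 left_mem_uIcc
    have hct := hc t right_mem_uIcc
    simp only [Pi.sub_apply, intervalIntegral.integral_same, sub_zero, hgw h0T, h0] at hc0
    simp only [Pi.sub_apply, hgw ht, ← hc0, sub_eq_zero] at hct
    exact hct
  · filter_upwards [hgd, hσ.ae_hasDerivAt_integral] with t h1 h2 ht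
    have ht' : t ∈ uIcc 0 T := by rw [uIcc_of_le hT.le]; exact Ioo_subset_Icc_self ht
    have h3 := (h2 ht' 0 left_mem_uIcc).sub
      ((innerSL ℝ e).hasFDerivAt.comp_hasDerivAt t h1.hasDerivAt)
    have hmono : MonotoneOn ((fun x => ∫ s in (0 : ℝ)..x, σ s) - (innerSL ℝ e) ∘ g) (Ioo 0 T) := by
      intro x hx y hy hxy
      have hx' := Ioo_subset_Ico_self hx
      have hy' := Ioo_subset_Ico_self hy
      have h5 := hle x hx' y hy' hxy
      have hsub : ∀ z ∈ Ioo 0 T, IntervalIntegrable σ volume 0 z := fun z hz =>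
        hσ.mono_set (by
          rw [uIcc_of_le hz.1.le, uIcc_of_le hT.le]
          exact Icc_subset_Icc_right hz.2.le)
      rw [← intervalIntegral.integral_interval_sub_left (hsub y hy) (hsub x hx), inner_sub_right]
        at h5
      simp only [Pi.sub_apply, Function.comp_apply, innerSL_apply_apply, hgw hx', hgw hy']
      linarith
    have h6 := HasDerivWithinAt.nonneg_of_monotoneOn (s := Ioo 0 T) ?_ h3.hasDerivWithinAt hmono
    · simpa using h6
    · have hev : ∀ᶠ x in 𝓝[≠] t, x ∈ Ioo 0 T :=
        mem_nhdsWithin_of_mem_nhds (Ioo_mem_nhds ht.1 ht.2)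
      exact accPt_iff_frequently_nhdsNE.2 hev.frequently

/-- A point of a Hilbert space belongs to a compact convex set if it satisfies the inequalities
of the support function in a dense set of directions. -/
lemma mem_range_of_forall_inner_le [CompleteSpace E] {U : Type*} [Nonempty U] {b : U → E}
    (hconv : Convex ℝ (range b)) (hcomp : IsCompact (range b)) {D : Set E} (hD : Dense D) {v : E}
    (hv : ∀ e ∈ D, inner ℝ e v ≤ ⨆ u, inner ℝ e (b u)) : v ∈ range b := by
  by_contra hvb
  obtain ⟨f, α, β, h1, hαβ, h2⟩ := geometric_hahn_banach_compact_closed hconv hcomp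
    (convex_singleton v) isClosed_singleton (disjoint_singleton_right.2 hvb)
  obtain ⟨R, hR⟩ := hcomp.isBounded.exists_norm_le
  obtain ⟨e, rfl⟩ := (InnerProductSpace.toDual ℝ E).surjective f
  simp only [InnerProductSpace.toDual_apply_apply] at h1 h2
  have h2 := h2 v rfl
  have hR0 : 0 ≤ R := (norm_nonneg _).trans (hR _ ⟨Classical.arbitrary U, rfl⟩)
  have hpos : 0 < R + ‖v‖ + 1 := by positivity
  obtain ⟨e', he', hdist⟩ := hD.exists_dist_lt e (div_pos (sub_pos.2 hαβ) hpos)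
  rw [dist_eq_norm, lt_div_iff₀ hpos] at hdist
  have h3 : ⨆ u, inner ℝ e' (b u) ≤ α + ‖e - e'‖ * R := by
    refine ciSup_le fun u => ?_
    have h4 : inner ℝ (e' - e) (b u) ≤ ‖e - e'‖ * R := by
      refine (real_inner_le_norm _ _).trans ?_
      rw [norm_sub_rev]
      exact mul_le_mul_of_nonneg_left (hR _ ⟨u, rfl⟩) (norm_nonneg _)
    rw [inner_sub_left] at h4
    linarith [h1 _ ⟨u, rfl⟩]
  have h5 := (hv e' he').trans h3
  have h6 : inner ℝ (e - e') v ≤ ‖e - e'‖ * ‖v‖ := real_inner_le_norm _ _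
  rw [inner_sub_left] at h6
  nlinarith [norm_nonneg (e - e')]

end Density

/-- A sequence of curves which is eventually bounded and equi-Lipschitz on each `[0, τ]`, `τ < T`,
has a subsequence converging pointwise on `[0, T)`. -/
lemma exists_subseq_tendsto_of_lipschitz {E : Type*} [NormedAddCommGroup E] [ProperSpace E]
    {T : ℝ} {y : ℕ → ℝ → E}
    (hy : ∀ τ ∈ Ico 0 T, ∃ R L : ℝ, ∀ᶠ k in atTop, (∀ t ∈ Icc 0 τ, ‖y k t‖ ≤ R) ∧
      ∀ s ∈ Icc 0 τ, ∀ t ∈ Icc 0 τ, s ≤ t → ‖y k t - y k s‖ ≤ L * (t - s)) :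
    ∃ φ : ℕ → ℕ, StrictMono φ ∧ ∃ z : ℝ → E, ∀ t ∈ Ico 0 T,
      Tendsto (fun k => y (φ k) t) atTop (𝓝 (z t)) := by
  classical
  choose! R L hRL using hy
  -- restriction to the rationals, cut off so as to take values in a compact product
  let x : ℕ → ℚ → E := fun k q => if ‖y k q‖ ≤ R q then y k q else 0
  have hcomp : IsCompact {f : ℚ → E | ∀ q : ℚ, f q ∈ Metric.closedBall (0 : E) |R q|} :=
    isCompact_pi_infinite fun q => isCompact_closedBall _ _
  obtain ⟨a, -, φ, hφ, hlim⟩ := hcomp.tendsto_subseq (x := x) (fun k q => by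
    simp only [x, mem_closedBall_zero_iff]
    split_ifs with h
    · exact h.trans (le_abs_self _)
    · simp)
  rw [tendsto_pi_nhds] at hlim
  have hrat : ∀ q : ℚ, (q : ℝ) ∈ Ico 0 T → Tendsto (fun k => y (φ k) q) atTop (𝓝 (a q)) := by
    intro q hq
    refine (hlim q).congr' ?_
    filter_upwards [hφ.tendsto_atTop.eventually (hRL q hq)] with k hk
    exact if_pos (hk.1 q ⟨hq.1, le_rfl⟩)
  have hcau : ∀ t ∈ Ico 0 T, CauchySeq fun k => y (φ k) t := by
    intro t ht
    rw [Metric.cauchySeq_iff]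
    intro ε hε
    obtain ⟨τ, hτ⟩ := exists_between ht.2
    have hτT : τ ∈ Ico 0 T := ⟨ht.1.trans hτ.1.le, hτ.2⟩
    obtain ⟨q, hq1, hq2⟩ := exists_rat_btwn
      (show t < min τ (t + ε / (3 * (|L τ| + 1))) from lt_min hτ.1 (by
        have : 0 < ε / (3 * (|L τ| + 1)) := by positivity
        linarith))
    rw [lt_min_iff] at hq2
    have hqτ : (q : ℝ) ∈ Icc 0 τ := ⟨ht.1.trans hq1.le, hq2.1.le⟩
    have htτ : t ∈ Icc 0 τ := ⟨ht.1, hτ.1.le⟩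
    have hclose : L τ * (q - t) < ε / 3 := by
      have h1 : (q - t) * (3 * (|L τ| + 1)) < ε := by
        rw [← lt_div_iff₀ (by positivity)]; linarith [hq2.2]
      have h2 : L τ * (q - t) ≤ |L τ| * (q - t) :=
        mul_le_mul_of_nonneg_right (le_abs_self _) (by linarith)
      nlinarith
    obtain ⟨N₁, hN₁⟩ := Metric.cauchySeq_iff.1 (hrat q ⟨hqτ.1, hqτ.2.trans_lt hτ.2⟩).cauchySeq
      (ε / 3) (by positivity)
    obtain ⟨N₂, hN₂⟩ := eventually_atTop.1 (hφ.tendsto_atTop.eventually (hRL τ hτT))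
    refine ⟨max N₁ N₂, fun m hm n hn => ?_⟩
    have h1 := hN₁ m ((le_max_left _ _).trans hm) n ((le_max_left _ _).trans hn)
    have h2 := (hN₂ m ((le_max_right _ _).trans hm)).2 t htτ q hqτ hq1.le
    have h3 := (hN₂ n ((le_max_right _ _).trans hn)).2 t htτ q hqτ hq1.le
    calc dist (y (φ m) t) (y (φ n) t)
        ≤ dist (y (φ m) t) (y (φ m) q) + dist (y (φ m) q) (y (φ n) q)
          + dist (y (φ n) q) (y (φ n) t) := dist_triangle4 _ _ _ _
      _ < ε := by
        rw [dist_eq_norm' (y (φ m) t), dist_eq_norm (y (φ n) q)]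
        linarith
  choose! z hz using fun t (ht : t ∈ Ico 0 T) => cauchySeq_tendsto_of_complete (hcau t ht)
  exact ⟨φ, hφ, z, hz⟩

/-! ### The right-hand side of the system -/

lemma norm_mul_norm_normalize_sub_le {E : Type*} [NormedAddCommGroup E] [NormedSpace ℝ E]
    (y z : E) : ‖z‖ * ‖‖y‖⁻¹ • y - ‖z‖⁻¹ • z‖ ≤ 2 * ‖y - z‖ := by
  rcases eq_or_ne z 0 with rfl | hz
  · simp
  rcases eq_or_ne y 0 with rfl | hy
  · have : ‖z‖ ≠ 0 := norm_ne_zero_iff.2 hz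
    simp only [norm_zero, inv_zero, smul_zero, zero_sub, norm_neg, norm_smul, norm_inv, norm_norm]
    rw [inv_mul_cancel₀ this]
    linarith [norm_nonneg z]
  have hz' : ‖z‖ ≠ 0 := norm_ne_zero_iff.2 hz
  have hy' : ‖y‖ ≠ 0 := norm_ne_zero_iff.2 hy
  have h1 : ‖z‖ • (‖y‖⁻¹ • y - ‖z‖⁻¹ • z) = (‖z‖ - ‖y‖) • (‖y‖⁻¹ • y) + (y - z) := by
    rw [smul_sub, sub_smul, smul_inv_smul₀ hz', smul_inv_smul₀ hy']
    abel
  calc ‖z‖ * ‖‖y‖⁻¹ • y - ‖z‖⁻¹ • z‖ = ‖‖z‖ • (‖y‖⁻¹ • y - ‖z‖⁻¹ • z)‖ := by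
        rw [norm_smul, norm_norm]
    _ ≤ ‖(‖z‖ - ‖y‖) • (‖y‖⁻¹ • y)‖ + ‖y - z‖ := by rw [h1]; exact norm_add_le _ _
    _ ≤ ‖y - z‖ + ‖y - z‖ := by
        gcongr
        rw [norm_smul, norm_smul, norm_inv, norm_norm, inv_mul_cancel₀ hy', mul_one,
          Real.norm_eq_abs, abs_sub_comm]
        exact abs_norm_sub_norm_le y z
    _ = 2 * ‖y - z‖ := by ring

namespace ControlSystem

variable {n : ℕ} {U : Type*} {S : ControlSystem n U}

/-- The part of the right-hand side which does not depend on the control. -/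
noncomputable def drift (S : ControlSystem n U) (t : ℝ) (y : EuclideanSpace ℝ (Fin n)) :
    EuclideanSpace ℝ (Fin n) :=
  S.G t ‖y‖ • (‖y‖⁻¹ • y) + S.opA t y

lemma f_eq_drift_add (t : ℝ) (y : EuclideanSpace ℝ (Fin n)) (u : U) :
    S.f t y u = S.drift t y + S.b t u := rfl

lemma drift_zero (t : ℝ) : S.drift t 0 = 0 := by simp [drift]

lemma P2.exists_lipschitz (h2 : S.P2) {M : ℝ} (hM : 0 < M) :
    ∃ C, 0 ≤ C ∧ ∀ t ∈ Icc 0 M, ∀ r ∈ Icc 0 M, ∀ s ∈ Icc 0 M,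
      |S.G t r - S.G t s| ≤ C * |r - s| := by
  obtain ⟨C, hC⟩ := h2.deriv_bounded M hM
  refine ⟨C, (abs_nonneg _).trans (hC 0 (left_mem_Icc.2 hM.le) 0 (left_mem_Icc.2 hM.le)),
    fun t ht r hr s hs => ?_⟩
  have hd : ∀ x ∈ Icc 0 M, HasDerivWithinAt (S.G t) (derivWithin (S.G t) (Ici 0) x) (Icc 0 M) x :=
    fun x hx => (((h2.contDiff t ht.1).differentiableOn one_ne_zero) x hx.1).hasDerivWithinAt.mono
      Icc_subset_Ici_self
  exact (convex_Icc 0 M).norm_image_sub_le_of_norm_hasDerivWithin_le hd (fun x hx => hC t ht x hx)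
    hs hr

lemma exists_lipschitz_drift (h2 : S.P2) (h3 : S.P3) {M : ℝ} (hM : 0 < M) :
    ∃ K, 0 ≤ K ∧ ∀ t ∈ Icc 0 M, ∀ y z : EuclideanSpace ℝ (Fin n), ‖y‖ ≤ M → ‖z‖ ≤ M →
      ‖S.drift t y - S.drift t z‖ ≤ K * ‖y - z‖ := by
  obtain ⟨C, hC0, hC⟩ := h2.exists_lipschitz hM
  obtain ⟨a, ha⟩ := h3.bounded M hM
  have ha0 : 0 ≤ a := (norm_nonneg _).trans (ha 0 (left_mem_Icc.2 hM.le))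
  refine ⟨3 * C + a, by positivity, fun t ht y z hy hz => ?_⟩
  have hsplit : S.drift t y - S.drift t z = (S.G t ‖y‖ - S.G t ‖z‖) • (‖y‖⁻¹ • y) +
      S.G t ‖z‖ • (‖y‖⁻¹ • y - ‖z‖⁻¹ • z) + S.opA t (y - z) := by
    simp only [drift, sub_smul, smul_sub, map_sub]
    abel
  have h1 : ‖(S.G t ‖y‖ - S.G t ‖z‖) • (‖y‖⁻¹ • y)‖ ≤ C * ‖y - z‖ := by
    have hunit : ‖‖y‖⁻¹ • y‖ ≤ 1 := by
      rw [norm_smul, norm_inv, norm_norm]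
      exact inv_mul_le_one
    rw [norm_smul, Real.norm_eq_abs]
    calc _ ≤ |S.G t ‖y‖ - S.G t ‖z‖| * 1 := by gcongr
      _ ≤ C * |‖y‖ - ‖z‖| := by
        rw [mul_one]; exact hC t ht _ ⟨norm_nonneg _, hy⟩ _ ⟨norm_nonneg _, hz⟩
      _ ≤ C * ‖y - z‖ := by gcongr; exact abs_norm_sub_norm_le y z
  have h2' : ‖S.G t ‖z‖ • (‖y‖⁻¹ • y - ‖z‖⁻¹ • z)‖ ≤ C * (2 * ‖y - z‖) := by
    have hG : |S.G t ‖z‖| ≤ C * ‖z‖ := by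
      have := hC t ht ‖z‖ ⟨norm_nonneg _, hz⟩ 0 ⟨le_rfl, hM.le⟩
      simpa [h2.zero t ht.1] using this
    rw [norm_smul, Real.norm_eq_abs]
    calc _ ≤ C * ‖z‖ * ‖‖y‖⁻¹ • y - ‖z‖⁻¹ • z‖ := by gcongr
      _ = C * (‖z‖ * ‖‖y‖⁻¹ • y - ‖z‖⁻¹ • z‖) := by ring
      _ ≤ _ := mul_le_mul_of_nonneg_left (norm_mul_norm_normalize_sub_le y z) hC0
  have h3' : ‖S.opA t (y - z)‖ ≤ a * ‖y - z‖ := (S.opA t).le_of_opNorm_le (ha t ht) _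
  rw [hsplit]
  calc _ ≤ _ := norm_add₃_le
    _ ≤ C * ‖y - z‖ + C * (2 * ‖y - z‖) + a * ‖y - z‖ := by gcongr
    _ = _ := by ring

lemma continuous_drift (h2 : S.P2) (h3 : S.P3) {t : ℝ} (ht : 0 ≤ t) : Continuous (S.drift t) := by
  refine continuous_iff_continuousAt.2 fun y => ?_
  obtain ⟨K, -, hK⟩ := exists_lipschitz_drift h2 h3 (M := max t (‖y‖ + 1)) (by positivity)
  have hev : ∀ᶠ z in 𝓝 y, ‖S.drift t z - S.drift t y‖ ≤ K * ‖z - y‖ := by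
    filter_upwards [continuous_norm.continuousAt.eventually (gt_mem_nhds (lt_add_one ‖y‖))]
      with z hz
    exact hK t ⟨ht, le_max_left _ _⟩ z y (hz.le.trans (le_max_right _ _))
      ((lt_add_one _).le.trans (le_max_right _ _))
  rw [ContinuousAt, tendsto_iff_norm_sub_tendsto_zero]
  refine squeeze_zero' (Eventually.of_forall fun _ => norm_nonneg _) hev ?_
  have : Tendsto (fun z => K * ‖z - y‖) (𝓝 y) (𝓝 (K * ‖y - y‖)) := by
    exact (Continuous.tendsto (by fun_prop) y)
  simpa using this

lemma P3.aemeasurable_opA_apply (h3 : S.P3) (x : EuclideanSpace ℝ (Fin n)) :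
    AEMeasurable (fun t => S.opA t x) (volume.restrict (Ici 0)) := by
  have h1 : (fun t => S.opA t x) = fun t => WithLp.toLp 2 fun i => ∑ j, S.A t i j * x j := by
    funext t
    ext i
    simp [opA, Matrix.mulVec, dotProduct]
  rw [h1]
  refine (WithLp.measurable_toLp 2 _).comp_aemeasurable (aemeasurable_pi_lambda _ fun i => ?_)
  exact Finset.aemeasurable_fun_sum _ fun j _ => (h3.measurable i j).mul_const _

lemma aemeasurable_drift_comp (h2 : S.P2) (h3 : S.P3) {μ : Measure ℝ}
    (hμ : μ ≤ volume.restrict (Ici 0)) {y : ℝ → EuclideanSpace ℝ (Fin n)} (hy : AEMeasurable y μ) :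
    AEMeasurable (fun s => S.drift s (y s)) μ := by
  refine aemeasurable_superposition (fun x => ?_) ?_ hy
  · have h4 : AEMeasurable (fun t => S.drift t x) (volume.restrict (Ici 0)) :=
      ((h2.measurable _ (norm_nonneg x)).smul_const _).add (h3.aemeasurable_opA_apply x)
    exact h4.mono_measure hμ
  · refine (ae_mono hμ) ?_
    filter_upwards [ae_restrict_mem measurableSet_Ici] with t ht
    exact continuous_drift h2 h3 ht

/-- The drift along a bounded continuous curve is integrable. -/
lemma intervalIntegrable_drift_comp (h2 : S.P2) (h3 : S.P3) {y : ℝ → EuclideanSpace ℝ (Fin n)}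
    {t : ℝ} (ht : 0 ≤ t) (hy : ContinuousOn y (Icc 0 t)) :
    IntervalIntegrable (fun s => S.drift s (y s)) volume 0 t := by
  obtain ⟨R, hR⟩ := (isCompact_Icc (a := 0) (b := t)).exists_bound_of_continuousOn hy
  obtain ⟨K, hK0, hK⟩ := exists_lipschitz_drift h2 h3 (M := max (max t R) 1) (by positivity)
  rw [intervalIntegrable_iff, uIoc_of_le ht]
  have hsub : Ioc 0 t ⊆ Icc 0 t := Ioc_subset_Icc_self
  have hle : volume.restrict (Ioc 0 t) ≤ volume.restrict (Ici (0 : ℝ)) :=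
    Measure.restrict_mono_set _ fun s hs => hs.1.le
  refine Integrable.of_bound (aemeasurable_drift_comp h2 h3 hle
    ((hy.mono hsub).aemeasurable measurableSet_Ioc)).aestronglyMeasurable
    (K * (max (max t R) 1)) ?_
  filter_upwards [ae_restrict_mem measurableSet_Ioc] with s hs
  have hys := hR s (hsub hs)
  have hys' : ‖y s‖ ≤ max (max t R) 1 := hys.trans ((le_max_right _ _).trans (le_max_left _ _))
  have := hK s ⟨hs.1.le, hs.2.trans ((le_max_left _ _).trans (le_max_left _ _))⟩ (y s) 0
    hys' (by simp)
  rw [drift_zero, sub_zero, sub_zero] at this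
  exact this.trans (by gcongr)

/-- On a bounded time interval the lower bound `ζ` for the radial growth may be replaced by a
continuous positive function `h`: the infimum over the times. It is locally Lipschitz, so at a zero
`x` it would be at most `K * (r - x)`, and so would be `ζ`, whereas `1 / (r - x)` is not integrable
at `x`. -/
lemma exists_continuous_growth (h2 : S.P2) (h3 : S.P3) (h5 : S.P5) {M : ℝ}
    (hM : 0 < M) : ∃ R₀, 0 < R₀ ∧ ∃ h : ℝ → ℝ, Continuous h ∧ (∀ x, 0 < h x) ∧
      (∀ t ∈ Icc 0 M, ∀ r, R₀ ≤ r → h r ≤ S.G t r - ‖S.opA t‖ * r - ⨆ u, ‖S.b t u‖) ∧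
      IntegrableOn (fun r => (h r)⁻¹) (Ici R₀) := by
  obtain ⟨R₀, hR₀, ζ, hζm, hζ0, hζ, hζint⟩ := h5
  let H : ℝ → ℝ → ℝ := fun t r => S.G t r - ‖S.opA t‖ * r - ⨆ u, ‖S.b t u‖
  let h : ℝ → ℝ := fun r => ⨅ t : Icc 0 M, H t (max r R₀)
  have : Nonempty (Icc 0 M) := ⟨⟨0, left_mem_Icc.2 hM.le⟩⟩
  have hζH : ∀ t ∈ Icc 0 M, ∀ r, ζ (max r R₀) ≤ H t (max r R₀) := fun t ht r =>
    hζ t ht.1 _ (le_max_right _ _)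
  have hbdd : ∀ r, BddBelow (range fun t : Icc 0 M => H t (max r R₀)) := fun r =>
    ⟨ζ (max r R₀), by rintro _ ⟨t, rfl⟩; exact hζH t t.2 r⟩
  have hζh : ∀ r, ζ (max r R₀) ≤ h r := fun r => le_ciInf fun t => hζH t t.2 r
  have hhH : ∀ t ∈ Icc 0 M, ∀ r, h r ≤ H t (max r R₀) := fun t ht r =>
    ciInf_le (hbdd r) ⟨t, ht⟩
  have hlip : ∀ N, ∃ K, 0 < K ∧ ∀ r ≤ N, ∀ s ≤ N, h r ≤ h s + K * |r - s| := by
    intro N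
    obtain ⟨C, hC0, hC⟩ := h2.exists_lipschitz (M := max M (max N R₀)) (by positivity)
    obtain ⟨a, ha⟩ := h3.bounded M hM
    have ha0 : 0 ≤ a := (norm_nonneg _).trans (ha 0 (left_mem_Icc.2 hM.le))
    refine ⟨C + a + 1, by positivity, fun r hr s hs => ?_⟩
    rw [← sub_le_iff_le_add]
    refine le_ciInf fun t => ?_
    have hmem : ∀ x ≤ N, max x R₀ ∈ Icc 0 (max M (max N R₀)) := fun x hx =>
      ⟨hR₀.le.trans (le_max_right _ _), (max_le_max_right R₀ hx).trans (le_max_right _ _)⟩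
    have h1 := hC t ⟨t.2.1, t.2.2.trans (le_max_left _ _)⟩ _ (hmem r hr) _ (hmem s hs)
    have h3' : |max r R₀ - max s R₀| ≤ |r - s| := abs_max_sub_max_le_abs r s R₀
    have h4 : |‖S.opA t‖ * (max r R₀ - max s R₀)| ≤ a * |r - s| := by
      rw [abs_mul, abs_norm]
      exact mul_le_mul (ha t t.2) h3' (abs_nonneg _) ha0
    have h5 := hhH t t.2 r
    simp only [H] at h5 ⊢
    have h6 := (abs_le.1 h4).1
    have h7 := (le_abs_self _).trans h1
    have h8 : C * |max r R₀ - max s R₀| ≤ C * |r - s| := by gcongr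
    nlinarith [abs_nonneg (r - s)]
  have hcont : Continuous h := by
    refine continuous_iff_continuousAt.2 fun x => ?_
    obtain ⟨K, hK0, hK⟩ := hlip (x + 1)
    rw [ContinuousAt, tendsto_iff_norm_sub_tendsto_zero]
    have hev : ∀ᶠ r in 𝓝 x, ‖h r - h x‖ ≤ K * |r - x| := by
      filter_upwards [gt_mem_nhds (lt_add_one x)] with r hr
      have h1 := hK r hr.le x (lt_add_one x).le
      have h2 := hK x (lt_add_one x).le r hr.le
      rw [abs_sub_comm x r] at h2
      rw [Real.norm_eq_abs, abs_le]
      constructor <;> linarith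
    refine squeeze_zero' (Eventually.of_forall fun _ => norm_nonneg _) hev ?_
    have : Tendsto (fun r => K * |r - x|) (𝓝 x) (𝓝 (K * |x - x|)) :=
      Continuous.tendsto (by fun_prop) x
    simpa using this
  have hpos : ∀ x, 0 < h x := by
    intro x
    by_contra hx
    -- `h x` only depends on `max x R₀`
    obtain ⟨x₀, hx₀, hhx₀⟩ : ∃ x₀, R₀ ≤ x₀ ∧ h x₀ ≤ 0 :=
      ⟨max x R₀, le_max_right _ _, by simpa [h, max_assoc] using hx⟩
    obtain ⟨K, hK0, hK⟩ := hlip (x₀ + 1)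
    have hζK : ∀ r ∈ Ioc x₀ (x₀ + 1), ENNReal.ofReal (K * (r - x₀))⁻¹ ≤
        (ENNReal.ofReal (ζ r))⁻¹ := by
      intro r hr
      have hr0 : 0 < r - x₀ := sub_pos.2 hr.1
      rw [ENNReal.ofReal_inv_of_pos (by positivity), ENNReal.inv_le_inv]
      refine ENNReal.ofReal_le_ofReal ?_
      have h1 := hζh r
      rw [max_eq_left (hx₀.trans hr.1.le)] at h1
      have h2 := hK r hr.2 x₀ (lt_add_one _).le
      rw [abs_of_pos hr0] at h2
      linarith
    have hfin : ∫⁻ r in Ioc x₀ (x₀ + 1), ENNReal.ofReal (K * (r - x₀))⁻¹ < ⊤ := by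
      refine lt_of_le_of_lt ?_ hζint
      calc _ ≤ ∫⁻ r in Ioc x₀ (x₀ + 1), (ENNReal.ofReal (ζ r))⁻¹ :=
            setLIntegral_mono' measurableSet_Ioc hζK
        _ ≤ _ := lintegral_mono_set fun r hr => hx₀.trans hr.1.le
    have hint : IntervalIntegrable (fun r => (K * (r - x₀))⁻¹) volume x₀ (x₀ + 1) := by
      rw [intervalIntegrable_iff, uIoc_of_le (by linarith)]
      refine ⟨(by fun_prop : Measurable _).aestronglyMeasurable, ?_⟩
      rw [hasFiniteIntegral_iff_ofReal]
      · exact hfin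
      · filter_upwards [ae_restrict_mem measurableSet_Ioc] with r hr
        have hr0 : 0 < r - x₀ := sub_pos.2 hr.1
        change 0 ≤ (K * (r - x₀))⁻¹
        positivity
    have h1 := hint.const_mul K
    have h2 : (fun r => K * (K * (r - x₀))⁻¹) = fun r => (r - x₀)⁻¹ := by
      funext r
      rw [mul_inv, mul_inv_cancel_left₀ hK0.ne']
    rw [h2, intervalIntegrable_sub_inv_iff] at h1
    simp at h1
  refine ⟨R₀, hR₀, h, hcont, hpos, fun t ht r hr => ?_, ?_⟩
  · have := hhH t ht r
    rwa [max_eq_left hr] at this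
  · refine ⟨(hcont.inv₀ fun x => (hpos x).ne').aestronglyMeasurable, ?_⟩
    rw [hasFiniteIntegral_iff_ofReal (Eventually.of_forall fun x => (inv_pos.2 (hpos x)).le)]
    refine lt_of_le_of_lt (setLIntegral_mono' measurableSet_Ici fun r hr => ?_) hζint
    rw [ENNReal.ofReal_inv_of_pos (hpos r), ENNReal.inv_le_inv]
    have := hζh r
    rw [max_eq_left hr] at this
    exact ENNReal.ofReal_le_ofReal this

lemma P4.bddAbove_norm [TopologicalSpace U] (h4 : S.P4) {t : ℝ} (ht : 0 ≤ t) :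
    BddAbove (range fun u => ‖S.b t u‖) := by
  obtain ⟨R, hR⟩ := (h4.compact t ht).isBounded.exists_norm_le
  exact ⟨R, by rintro _ ⟨u, rfl⟩; exact hR _ ⟨u, rfl⟩⟩

/-- The growth condition at the single radius `R₀` bounds `b` on bounded time intervals. -/
lemma exists_bound_b [TopologicalSpace U] (h2 : S.P2) (h4 : S.P4) (h5 : S.P5) {M : ℝ}
    (hM : 0 < M) :
    ∃ β, 0 ≤ β ∧ ∀ t ∈ Icc 0 M, ∀ u, ‖S.b t u‖ ≤ β := by
  obtain ⟨R₀, hR₀, ζ, -, hζ0, hζ, -⟩ := h5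
  obtain ⟨C, hC0, hC⟩ := h2.exists_lipschitz (M := max M R₀) (by positivity)
  refine ⟨C * R₀, by positivity, fun t ht u => ?_⟩
  have h1 : ‖S.b t u‖ ≤ ⨆ u, ‖S.b t u‖ := le_ciSup (h4.bddAbove_norm ht.1) u
  have h2' := hC t ⟨ht.1, ht.2.trans (le_max_left _ _)⟩ R₀ ⟨hR₀.le, le_max_right _ _⟩ 0
    ⟨le_rfl, hR₀.le.trans (le_max_right _ _)⟩
  rw [h2.zero t ht.1, sub_zero, sub_zero, abs_of_pos hR₀] at h2'
  have h3 := hζ t ht.1 R₀ le_rfl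
  have h4' : 0 ≤ ‖S.opA t‖ * R₀ := by positivity
  linarith [hζ0 R₀ le_rfl, le_abs_self (S.G t R₀)]

/-! ### Solutions: uniqueness, growth and a priori bounds -/

namespace IsSolutionOn

variable {T : ℝ} {y z : ℝ → EuclideanSpace ℝ (Fin n)} {u : ℝ → U}

lemma intervalIntegrable (hy : S.IsSolutionOn T y u) {t : ℝ} (ht : t ∈ Ico 0 T) :
    IntervalIntegrable (fun s => S.f s (y s) (u s)) volume 0 t := by
  rcases ht.1.eq_or_lt with rfl | h0
  · simp
  · exact (hy.2 t ⟨h0, ht.2⟩).1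

lemma initial (hT : 0 < T) (hy : S.IsSolutionOn T y u) : y 0 = S.y₀ := by
  have h0T : (0 : ℝ) ∈ Ico 0 T := ⟨le_rfl, hT⟩
  have hT2 : T / 2 ∈ Ico 0 T := ⟨by linarith, by linarith⟩
  have hI : Ioo 0 (T / 2) ∈ 𝓝[>] (0 : ℝ) := Ioo_mem_nhdsGT (by linarith)
  have h1 : Tendsto y (𝓝[>] 0) (𝓝 (y 0)) :=
    (hy.1 0 h0T).mono_left (nhdsWithin_le_of_mem
      (mem_of_superset hI fun s hs => ⟨hs.1.le, hs.2.trans hT2.2⟩))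
  have h2 := intervalIntegral.continuousOn_primitive_interval'
    (hy.intervalIntegrable hT2) left_mem_uIcc 0 left_mem_uIcc
  have h3 : Tendsto (fun t => S.y₀ + ∫ s in (0 : ℝ)..t, S.f s (y s) (u s)) (𝓝[>] 0)
      (𝓝 (S.y₀ + ∫ s in (0 : ℝ)..0, S.f s (y s) (u s))) := by
    refine tendsto_const_nhds.add (h2.mono_left (nhdsWithin_le_of_mem
      (mem_of_superset hI fun s hs => ?_)))
    rw [uIcc_of_le hT2.1]
    exact Ioo_subset_Icc_self hs
  have h4 : Tendsto y (𝓝[>] 0) (𝓝 (S.y₀ + ∫ s in (0 : ℝ)..0, S.f s (y s) (u s))) := by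
    refine h3.congr' ?_
    filter_upwards [hI] with t ht
    exact (hy.2 t ⟨ht.1, ht.2.trans hT2.2⟩).2.symm
  simpa using tendsto_nhds_unique h1 h4

lemma eq_integral (hT : 0 < T) (hy : S.IsSolutionOn T y u) {t : ℝ} (ht : t ∈ Ico 0 T) :
    y t = S.y₀ + ∫ s in (0 : ℝ)..t, S.f s (y s) (u s) := by
  rcases ht.1.eq_or_lt with rfl | h0
  · simpa using hy.initial hT
  · exact (hy.2 t ⟨h0, ht.2⟩).2

lemma sub_eq_integral (hT : 0 < T) (hy : S.IsSolutionOn T y u) {s t : ℝ} (hs : s ∈ Ico 0 T)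
    (ht : t ∈ Ico 0 T) : y t - y s = ∫ x in s..t, S.f x (y x) (u x) := by
  rw [hy.eq_integral hT ht, hy.eq_integral hT hs, add_sub_add_left_eq_sub,
    intervalIntegral.integral_interval_sub_left (hy.intervalIntegrable ht)
      (hy.intervalIntegrable hs)]

lemma intervalIntegrable' (hy : S.IsSolutionOn T y u) {s t : ℝ} (hs : s ∈ Ico 0 T)
    (ht : t ∈ Ico 0 T) : IntervalIntegrable (fun x => S.f x (y x) (u x)) volume s t :=
  (hy.intervalIntegrable hs).symm.trans (hy.intervalIntegrable ht)

lemma eqOn (h2 : S.P2) (h3 : S.P3) (hT : 0 < T) (hy : S.IsSolutionOn T y u)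
    (hz : S.IsSolutionOn T z u) : EqOn y z (Ico 0 T) := by
  intro τ hτ
  have hsub : Icc 0 τ ⊆ Ico 0 T := fun s hs => ⟨hs.1, hs.2.trans_lt hτ.2⟩
  obtain ⟨R, hR⟩ := (isCompact_Icc (a := 0) (b := τ)).exists_bound_of_continuousOn (hy.1.mono hsub)
  obtain ⟨R', hR'⟩ := (isCompact_Icc (a := 0) (b := τ)).exists_bound_of_continuousOn
    (hz.1.mono hsub)
  obtain ⟨K, hK0, hK⟩ := exists_lipschitz_drift h2 h3 (M := max T (max R R')) (by positivity)
  have hcont : ContinuousOn (fun t => ‖y t - z t‖) (Icc 0 τ) :=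
    ((hy.1.mono hsub).sub (hz.1.mono hsub)).norm
  have key := eq_zero_of_le_mul_integral hcont (fun _ _ => norm_nonneg _) (K := K) (fun t ht => by
    have ht' := hsub ht
    rw [hy.eq_integral hT ht', hz.eq_integral hT ht', add_sub_add_left_eq_sub,
      ← intervalIntegral.integral_sub (hy.intervalIntegrable ht') (hz.intervalIntegrable ht'),
      ← intervalIntegral.integral_const_mul]
    refine intervalIntegral.norm_integral_le_of_norm_le ht.1 ?_ ?_
    · refine Eventually.of_forall fun s hs => ?_
      have hs' : s ∈ Icc 0 τ := ⟨hs.1.le, hs.2.trans ht.2⟩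
      rw [f_eq_drift_add, f_eq_drift_add, add_sub_add_right_eq_sub]
      exact hK s ⟨hs'.1, (hsub hs').2.le.trans (le_max_left _ _)⟩ _ _
        ((hR s hs').trans ((le_max_left _ _).trans (le_max_right _ _)))
        ((hR' s hs').trans ((le_max_right _ _).trans (le_max_right _ _)))
    · refine ContinuousOn.intervalIntegrable ?_
      rw [uIcc_of_le ht.1]
      exact continuousOn_const.mul (hcont.mono (Icc_subset_Icc_right ht.2))) τ ⟨hτ.1, le_rfl⟩
  exact sub_eq_zero.1 (norm_eq_zero.1 key)

/-- The lower right Dini derivative of `‖y‖` at `t` is at least the radial lower bound of the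
right-hand side: compare `‖y s‖` with the component of `y s` in the direction of `y t`. -/
lemma eventually_mul_le_norm_sub [TopologicalSpace U] (h2 : S.P2) (h3 : S.P3) (h4 : S.P4)
    (hy : S.IsSolutionOn T y u) {t c c₀ : ℝ} (ht : t ∈ Ico 0 T) (hyt : 0 < ‖y t‖)
    (hc₀ : ∀ τ ∈ Icc 0 T, c₀ ≤ S.G τ ‖y t‖ - ‖S.opA τ‖ * ‖y t‖ - ⨆ u, ‖S.b τ u‖) (hc : c < c₀) :
    ∀ᶠ s in 𝓝[>] t, c * (s - t) ≤ ‖y s‖ - ‖y t‖ := by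
  have hT : 0 < T := ht.1.trans_lt ht.2
  obtain ⟨K, hK0, hK⟩ := exists_lipschitz_drift h2 h3 (M := max T (‖y t‖ + 1)) (by positivity)
  set e : EuclideanSpace ℝ (Fin n) := ‖y t‖⁻¹ • y t with he
  have he1 : ‖e‖ = 1 := by rw [he, norm_smul, norm_inv, norm_norm, inv_mul_cancel₀ hyt.ne']
  have hey : inner ℝ e (y t) = ‖y t‖ := by
    rw [he, real_inner_smul_left, real_inner_self_eq_norm_sq]
    field_simp
  have hnear : ∀ᶠ s in 𝓝[≥] t, s ∈ Ico 0 T ∧ ‖y s - y t‖ < min 1 ((c₀ - c) / (K + 1)) := by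
    have hmem : Ico 0 T ∈ 𝓝[≥] t :=
      mem_of_superset (Ico_mem_nhdsGE ht.2) (Ico_subset_Ico_left ht.1)
    have hlim : Tendsto y (𝓝[≥] t) (𝓝 (y t)) :=
      (hy.1 t ht).mono_left (nhdsWithin_le_of_mem hmem)
    have hpos : 0 < min 1 ((c₀ - c) / (K + 1)) :=
      lt_min one_pos (div_pos (sub_pos.2 hc) (by positivity))
    filter_upwards [hmem, (tendsto_iff_norm_sub_tendsto_zero.1 hlim).eventually
      (gt_mem_nhds hpos)] with s h1 h2 using ⟨h1, h2⟩
  obtain ⟨σ, hσ, hσsub⟩ := mem_nhdsGE_iff_exists_Ico_subset.1 hnear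
  filter_upwards [Ioo_mem_nhdsGT hσ] with s hs
  have hsT : s ∈ Ico 0 T := (hσsub ⟨hs.1.le, hs.2⟩).1
  have hlow : ∀ τ ∈ Icc t s, c ≤ inner ℝ e (S.f τ (y τ) (u τ)) := by
    intro τ hτ
    obtain ⟨hτT, hτy⟩ := hσsub ⟨hτ.1, hτ.2.trans_lt hs.2⟩
    rw [lt_min_iff, lt_div_iff₀ (by positivity)] at hτy
    have hτ0 : 0 ≤ τ := hτT.1
    have h5 : ‖S.drift τ (y τ) - S.drift τ (y t)‖ ≤ K * ‖y τ - y t‖ := by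
      refine hK τ ⟨hτ0, hτT.2.le.trans (le_max_left _ _)⟩ _ _ (le_trans ?_ (le_max_right _ _))
        ((lt_add_one _).le.trans (le_max_right _ _))
      have := norm_le_norm_add_norm_sub' (y τ) (y t)
      linarith [hτy.1]
    have h6 : -‖S.drift τ (y τ) - S.drift τ (y t)‖ ≤
        inner ℝ e (S.drift τ (y τ) - S.drift τ (y t)) := by
      have := abs_real_inner_le_norm e (S.drift τ (y τ) - S.drift τ (y t))
      rw [he1, one_mul] at this
      exact (abs_le.1 this).1
    have h7 : S.G τ ‖y t‖ - ‖S.opA τ‖ * ‖y t‖ ≤ inner ℝ e (S.drift τ (y t)) := by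
      have h8 : -(‖S.opA τ‖ * ‖y t‖) ≤ inner ℝ e (S.opA τ (y t)) := by
        have := abs_real_inner_le_norm e (S.opA τ (y t))
        rw [he1, one_mul] at this
        exact (abs_le.1 (this.trans ((S.opA τ).le_opNorm _))).1
      rw [drift, inner_add_right, real_inner_smul_right, ← he, real_inner_self_eq_norm_sq, he1]
      linarith
    have h9 : -(⨆ u, ‖S.b τ u‖) ≤ inner ℝ e (S.b τ (u τ)) := by
      have := abs_real_inner_le_norm e (S.b τ (u τ))
      rw [he1, one_mul] at this
      exact (abs_le.1 (this.trans (le_ciSup (h4.bddAbove_norm hτ0) (u τ)))).1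
    have h10 := hc₀ τ ⟨hτ0, hτT.2.le⟩
    rw [f_eq_drift_add, inner_add_right]
    rw [inner_sub_right] at h6
    nlinarith [hτy.2, norm_nonneg (y τ - y t)]
  have hint := hy.intervalIntegrable' ht hsT
  have h5 : inner ℝ e (y s - y t) = ∫ τ in t..s, inner ℝ e (S.f τ (y τ) (u τ)) := by
    rw [hy.sub_eq_integral hT ht hsT]
    exact ((innerSL ℝ e).intervalIntegral_comp_comm hint).symm
  have h6 : c * (s - t) ≤ inner ℝ e (y s - y t) := by
    rw [h5]
    have := intervalIntegral.integral_mono_on hs.1.le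
      (intervalIntegrable_const (c := c)) ((innerSL ℝ e).integrable_comp hint.1 |> fun h =>
        (intervalIntegrable_iff_integrableOn_Ioc_of_le hs.1.le).2 h) hlow
    rw [intervalIntegral.integral_const, smul_eq_mul, mul_comm] at this
    exact this
  have h7 : inner ℝ e (y s) ≤ ‖y s‖ := by
    simpa [he1] using real_inner_le_norm e (y s)
  rw [inner_sub_right, hey] at h6
  linarith

end IsSolutionOn

/-- A solution with existence time at most `M` is bounded, uniformly in the control, up to time
`ε` before the end of its interval of existence: from a large radius the radius would reach
infinity earlier than that. -/
lemma exists_apriori_bound [TopologicalSpace U] (h2 : S.P2) (h3 : S.P3) (h4 : S.P4) (h5 : S.P5)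
    {M ε : ℝ} (hM : 0 < M) (hε : 0 < ε) :
    ∃ R, ∀ T ≤ M, ∀ (y : ℝ → EuclideanSpace ℝ (Fin n)) (u : ℝ → U), S.IsSolutionOn T y u →
      ∀ t, 0 ≤ t → t + ε < T → ‖y t‖ ≤ R := by
  obtain ⟨R₀, hR₀, h, hcont, hpos, hH, hint⟩ := exists_continuous_growth h2 h3 h5 hM
  have hinv : Continuous fun x => (h x)⁻¹ := hcont.inv₀ fun x => (hpos x).ne'
  have hIoi : IntegrableOn (fun r => (h r)⁻¹) (Ioi R₀) := hint.mono_set Ioi_subset_Ici_self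
  have hlim := intervalIntegral_tendsto_integral_Ioi R₀ hIoi tendsto_id
  obtain ⟨R, hRI, hRR₀⟩ := ((hlim.eventually (lt_mem_nhds (sub_lt_self _ hε))).and
    (eventually_ge_atTop R₀)).exists
  refine ⟨R, fun T hTM y u hy t ht htT => ?_⟩
  by_contra! hcon
  have hRy : R₀ ≤ ‖y t‖ := hRR₀.trans hcon.le
  have hsub : Icc t (t + ε) ⊆ Ico 0 T := fun s hs => ⟨ht.trans hs.1, hs.2.trans_lt htT⟩
  obtain ⟨h6, h7⟩ := sub_le_integral_inv_of_growth (r := fun s => ‖y s‖) (h := h) (R₀ := R₀)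
    (by linarith : t ≤ t + ε) (hy.1.mono hsub).norm hcont hpos hRy (fun s hs hRs c hc =>
      hy.eventually_mul_le_norm_sub h2 h3 h4 (hsub (Ico_subset_Icc_self hs)) (hR₀.trans_le hRs)
        (fun τ hτ => hH τ ⟨hτ.1, hτ.2.trans hTM⟩ _ hRs) hc)
  have hii : ∀ a b, IntervalIntegrable (fun x => (h x)⁻¹) volume a b := fun a b =>
    hinv.intervalIntegrable a b
  have h8 : ∫ x in R₀..‖y (t + ε)‖, (h x)⁻¹ ≤ ∫ x in Ioi R₀, (h x)⁻¹ := by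
    rw [intervalIntegral.integral_of_le (hRy.trans h6)]
    exact setIntegral_mono_set hIoi (Eventually.of_forall fun x => (inv_pos.2 (hpos x)).le)
      (Ioc_subset_Ioi_self).eventuallyLE
  have h9 : 0 ≤ ∫ x in R..‖y t‖, (h x)⁻¹ :=
    intervalIntegral.integral_nonneg hcon.le fun x _ => (inv_pos.2 (hpos x)).le
  have h10 := intervalIntegral.integral_add_adjacent_intervals (hii R₀ R) (hii R ‖y t‖)
  have h11 := intervalIntegral.integral_add_adjacent_intervals (hii R₀ ‖y t‖)
    (hii ‖y t‖ ‖y (t + ε)‖)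
  simp only [id] at hRI
  linarith

/-! ### Limits of solutions -/

section Support

variable [TopologicalSpace U]

/-- The support function of `b(t, U)` in the direction `e`. -/
noncomputable def supp (S : ControlSystem n U) (e : EuclideanSpace ℝ (Fin n)) (t : ℝ) : ℝ :=
  ⨆ u, inner ℝ e (S.b t u)

lemma P4.inner_le_supp (h4 : S.P4) (e : EuclideanSpace ℝ (Fin n)) {t : ℝ} (ht : 0 ≤ t) (u : U) :
    inner ℝ e (S.b t u) ≤ S.supp e t := by
  obtain ⟨R, hR⟩ := h4.bddAbove_norm ht
  refine le_ciSup (f := fun u => inner ℝ e (S.b t u)) ⟨‖e‖ * R, ?_⟩ u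
  rintro _ ⟨u, rfl⟩
  exact (real_inner_le_norm _ _).trans
    (mul_le_mul_of_nonneg_left (hR ⟨u, rfl⟩) (norm_nonneg _))

lemma P4.aemeasurable_supp [TopologicalSpace.SeparableSpace U] [Nonempty U] (h4 : S.P4)
    (e : EuclideanSpace ℝ (Fin n)) : AEMeasurable (S.supp e) (volume.restrict (Ici 0)) := by
  have h1 : AEMeasurable (fun t => ⨆ i, inner ℝ e (S.b t (TopologicalSpace.denseSeq U i)))
      (volume.restrict (Ici 0)) :=
    AEMeasurable.iSup fun i => (aemeasurable_const (b := e)).inner (h4.measurable _)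
  refine h1.congr ?_
  filter_upwards [ae_restrict_mem measurableSet_Ici] with t ht
  have ht : 0 ≤ t := ht
  refine le_antisymm (ciSup_le fun i => h4.inner_le_supp e ht _) (ciSup_le fun u => ?_)
  have hbdd : BddAbove (range fun i => inner ℝ e (S.b t (TopologicalSpace.denseSeq U i))) :=
    ⟨S.supp e t, by rintro _ ⟨i, rfl⟩; exact h4.inner_le_supp e ht _⟩
  have hcl : IsClosed {u | inner ℝ e (S.b t u) ≤
      ⨆ i, inner ℝ e (S.b t (TopologicalSpace.denseSeq U i))} :=
    isClosed_le (continuous_const.inner (h4.continuous t ht)) continuous_const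
  have hsub : range (TopologicalSpace.denseSeq U) ⊆ {u | inner ℝ e (S.b t u) ≤
      ⨆ i, inner ℝ e (S.b t (TopologicalSpace.denseSeq U i))} := by
    rintro _ ⟨i, rfl⟩
    exact le_ciSup hbdd i
  exact hcl.closure_subset_iff.2 hsub (TopologicalSpace.denseRange_denseSeq U u)

lemma intervalIntegrable_supp [TopologicalSpace.SeparableSpace U] [Nonempty U] (h4 : S.P4)
    {M β : ℝ} (hM : 0 < M) (hβ : ∀ t ∈ Icc 0 M, ∀ u, ‖S.b t u‖ ≤ β)
    (e : EuclideanSpace ℝ (Fin n)) : IntervalIntegrable (S.supp e) volume 0 M := by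
  rw [intervalIntegrable_iff, uIoc_of_le hM.le]
  refine Integrable.of_bound ((h4.aemeasurable_supp e).mono_measure
    (Measure.restrict_mono_set _ fun s hs => hs.1.le)).aestronglyMeasurable (‖e‖ * β) ?_
  filter_upwards [ae_restrict_mem measurableSet_Ioc] with t ht
  have hb : ∀ u, |inner ℝ e (S.b t u)| ≤ ‖e‖ * β := fun u =>
    (abs_real_inner_le_norm _ _).trans
      (mul_le_mul_of_nonneg_left (hβ t (Ioc_subset_Icc_self ht) u) (norm_nonneg _))
  rw [Real.norm_eq_abs, abs_le]
  refine ⟨?_, ciSup_le fun u => (abs_le.1 (hb u)).2⟩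
  exact (abs_le.1 (hb (Classical.arbitrary U))).1.trans (h4.inner_le_supp e ht.1.le _)

end Support

lemma IsSolutionOn.eventually_bounds [TopologicalSpace U] (h2 : S.P2) (h3 : S.P3) (h4 : S.P4)
    (h5 : S.P5) {M : ℝ} {T : ℕ → ℝ} {y : ℕ → ℝ → EuclideanSpace ℝ (Fin n)} {u : ℕ → ℝ → U}
    (hT : ∀ k, T k ≤ M) (hTlim : Tendsto T atTop (𝓝 M))
    (hy : ∀ k, S.IsSolutionOn (T k) (y k) (u k)) {τ : ℝ} (hτ : τ ∈ Ico 0 M) :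
    ∃ R L : ℝ, ∀ᶠ k in atTop, (∀ t ∈ Icc 0 τ, ‖y k t‖ ≤ R) ∧
      ∀ s ∈ Icc 0 τ, ∀ t ∈ Icc 0 τ, s ≤ t → ‖y k t - y k s‖ ≤ L * (t - s) := by
  have hM : 0 < M := hτ.1.trans_lt hτ.2
  obtain ⟨β, hβ0, hβ⟩ := exists_bound_b h2 h4 h5 hM
  obtain ⟨R, hR⟩ := exists_apriori_bound h2 h3 h4 h5 hM (half_pos (sub_pos.2 hτ.2))
  obtain ⟨K, hK0, hK⟩ := exists_lipschitz_drift h2 h3 (M := max M R) (by positivity)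
  refine ⟨R, K * R + β, ?_⟩
  filter_upwards [hTlim.eventually (lt_mem_nhds (by linarith [hτ.2] : τ + (M - τ) / 2 < M))]
    with k hk
  have hsub : Icc 0 τ ⊆ Ico 0 (T k) := fun s hs => ⟨hs.1, by linarith [hs.2, hτ.2]⟩
  have hbd : ∀ t ∈ Icc 0 τ, ‖y k t‖ ≤ R := fun t ht =>
    hR (T k) (hT k) (y k) (u k) (hy k) t ht.1 (by linarith [ht.2])
  refine ⟨hbd, fun s hs t ht hst => ?_⟩
  rw [(hy k).sub_eq_integral ((hτ.1.trans_lt (hsub ⟨hτ.1, le_rfl⟩).2)) (hsub hs) (hsub ht)]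
  rw [← abs_of_nonneg (sub_nonneg.2 hst)]
  refine intervalIntegral.norm_integral_le_of_norm_le_const fun x hx => ?_
  rw [uIoc_of_le hst] at hx
  have hx' : x ∈ Icc 0 τ := ⟨hs.1.trans hx.1.le, hx.2.trans ht.2⟩
  have hxM : x ≤ M := hx'.2.trans hτ.2.le
  have h6 := hK x ⟨hx'.1, hxM.trans (le_max_left _ _)⟩ (y k x) 0
    ((hbd x hx').trans (le_max_right _ _)) (by simpa using Or.inl hM.le)
  rw [drift_zero, sub_zero, sub_zero] at h6
  rw [f_eq_drift_add]
  calc _ ≤ ‖S.drift x (y k x)‖ + ‖S.b x (u k x)‖ := norm_add_le _ _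
    _ ≤ K * ‖y k x‖ + β := add_le_add h6 (hβ x ⟨hx'.1, hxM⟩ _)
    _ ≤ K * R + β := by gcongr; exact hbd x hx'

/-- Passage to the limit in the drift term, by dominated convergence. -/
lemma tendsto_integral_drift (h2 : S.P2) (h3 : S.P3) {t R : ℝ} (ht : 0 ≤ t)
    {y : ℕ → ℝ → EuclideanSpace ℝ (Fin n)} {z : ℝ → EuclideanSpace ℝ (Fin n)}
    (hyc : ∀ᶠ k in atTop, ContinuousOn (y k) (Icc 0 t))
    (hyR : ∀ᶠ k in atTop, ∀ s ∈ Icc 0 t, ‖y k s‖ ≤ R)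
    (hlim : ∀ s ∈ Icc 0 t, Tendsto (fun k => y k s) atTop (𝓝 (z s))) :
    Tendsto (fun k => ∫ s in (0 : ℝ)..t, S.drift s (y k s)) atTop
      (𝓝 (∫ s in (0 : ℝ)..t, S.drift s (z s))) := by
  obtain ⟨K, hK0, hK⟩ := exists_lipschitz_drift h2 h3 (M := max (max t R) 1) (by positivity)
  refine intervalIntegral.tendsto_integral_filter_of_dominated_convergence (fun _ => K * R) ?_ ?_
    intervalIntegrable_const ?_
  · filter_upwards [hyc] with k hk
    rw [uIoc_of_le ht]
    exact (intervalIntegrable_drift_comp h2 h3 ht hk).1.aestronglyMeasurable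
  · filter_upwards [hyR] with k hk
    refine Eventually.of_forall fun s hs => ?_
    rw [uIoc_of_le ht] at hs
    have hs' := Ioc_subset_Icc_self hs
    have h6 := hK s ⟨hs'.1, hs'.2.trans ((le_max_left _ _).trans (le_max_left _ _))⟩ (y k s) 0
      ((hk s hs').trans ((le_max_right _ _).trans (le_max_left _ _))) (by simp)
    rw [drift_zero, sub_zero, sub_zero] at h6
    exact h6.trans (by gcongr; exact hk s hs')
  · refine Eventually.of_forall fun s hs => ?_
    rw [uIoc_of_le ht] at hs
    exact ((continuous_drift h2 h3 hs.1.le).tendsto _).comp (hlim s (Ioc_subset_Icc_self hs))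

/-- If solutions exist on `[0, T k)` and `T k ↑ M`, then some measurable control has a solution on
`[0, M)`, namely the pointwise limit of a subsequence. -/
lemma exists_isSolutionOn_of_tendsto [MetricSpace U] [TopologicalSpace.SeparableSpace U]
    [MeasurableSpace U] [BorelSpace U] (hU : AnalyticSet (univ : Set U)) [Nonempty U]
    (h2 : S.P2) (h3 : S.P3) (h4 : S.P4) (h5 : S.P5) {M : ℝ} (hM : 0 < M) {T : ℕ → ℝ}
    {y : ℕ → ℝ → EuclideanSpace ℝ (Fin n)} {u : ℕ → ℝ → U} (hT0 : ∀ k, 0 < T k)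
    (hT : ∀ k, T k ≤ M) (hTlim : Tendsto T atTop (𝓝 M))
    (hy : ∀ k, S.IsSolutionOn (T k) (y k) (u k)) :
    ∃ (z : ℝ → EuclideanSpace ℝ (Fin n)) (v : ℝ → U), Measurable v ∧ S.IsSolutionOn M z v := by
  -- pass to a subsequence which converges pointwise
  obtain ⟨φ, hφ, z, hz⟩ := exists_subseq_tendsto_of_lipschitz (T := M) (y := y) fun τ hτ =>
    IsSolutionOn.eventually_bounds h2 h3 h4 h5 hT hTlim hy hτ
  replace hTlim := hTlim.comp hφ.tendsto_atTop
  have hbounds : ∀ τ ∈ Ico 0 M, ∃ R L : ℝ, ∀ᶠ k in atTop, (∀ t ∈ Icc 0 τ, ‖y (φ k) t‖ ≤ R) ∧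
      ∀ s ∈ Icc 0 τ, ∀ t ∈ Icc 0 τ, s ≤ t → ‖y (φ k) t - y (φ k) s‖ ≤ L * (t - s) := fun τ hτ =>
    IsSolutionOn.eventually_bounds h2 h3 h4 h5 (fun k => hT (φ k)) hTlim (fun k => hy (φ k)) hτ
  have hsub : ∀ {τ}, τ ∈ Ico 0 M → Icc 0 τ ⊆ Ico 0 M := fun hτ s hs => ⟨hs.1, hs.2.trans_lt hτ.2⟩
  have hTτ : ∀ τ ∈ Ico 0 M, ∀ᶠ k in atTop, τ ∈ Ico 0 (T (φ k)) := fun τ hτ =>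
    (hTlim.eventually (lt_mem_nhds hτ.2)).mono fun k hk => ⟨hτ.1, hk⟩
  have hzc : ContinuousOn z (Ico 0 M) := by
    intro t ht
    obtain ⟨τ, hτ⟩ := exists_between ht.2
    have hτM : τ ∈ Ico 0 M := ⟨ht.1.trans hτ.1.le, hτ.2⟩
    obtain ⟨R, L, hRL⟩ := hbounds τ hτM
    have hzL : ∀ s ∈ Icc 0 τ, ∀ t ∈ Icc 0 τ, s ≤ t → ‖z t - z s‖ ≤ L * (t - s) :=
      fun s hs t ht hst => le_of_tendsto ((hz t (hsub hτM ht)).sub (hz s (hsub hτM hs))).norm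
        (hRL.mono fun k hk => hk.2 s hs t ht hst)
    have hlip : LipschitzOnWith L.toNNReal z (Icc 0 τ) := by
      refine LipschitzOnWith.of_dist_le_mul fun s hs t ht => ?_
      wlog hst : s ≤ t generalizing s t
      · rw [dist_comm, dist_comm s]
        exact this t ht s hs (le_of_not_ge hst)
      rw [dist_comm, dist_comm s, dist_eq_norm, Real.dist_eq, abs_of_nonneg (sub_nonneg.2 hst)]
      exact (hzL s hs t ht hst).trans
        (mul_le_mul_of_nonneg_right (Real.le_coe_toNNReal L) (sub_nonneg.2 hst))
    exact ((hlip.continuousOn t ⟨ht.1, hτ.1.le⟩).mono_of_mem_nhdsWithin (by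
      refine mem_nhdsWithin.2 ⟨Iio τ, isOpen_Iio, hτ.1, fun s hs => ⟨hs.2.1, hs.1.le⟩⟩))
  have hdriftk : ∀ k, ∀ t ∈ Ico 0 (T k),
      IntervalIntegrable (fun s => S.drift s (y k s)) volume 0 t := fun k t ht =>
    intervalIntegrable_drift_comp h2 h3 ht.1
      ((hy k).1.mono fun s hs => ⟨hs.1, hs.2.trans_lt ht.2⟩)
  -- the contributions of the controls to the solutions, and their limit
  let W : ℕ → ℝ → EuclideanSpace ℝ (Fin n) := fun k t =>
    y k t - S.y₀ - ∫ s in (0 : ℝ)..t, S.drift s (y k s)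
  let w : ℝ → EuclideanSpace ℝ (Fin n) := fun t =>
    z t - S.y₀ - ∫ s in (0 : ℝ)..t, S.drift s (z s)
  have hWw : ∀ t ∈ Ico 0 M, Tendsto (fun k => W (φ k) t) atTop (𝓝 (w t)) := by
    intro t ht
    obtain ⟨R, L, hRL⟩ := hbounds t ht
    refine ((hz t ht).sub_const _).sub (tendsto_integral_drift h2 h3 ht.1 ?_
      (hRL.mono fun k hk => hk.1) fun s hs => hz s (hsub ht hs))
    filter_upwards [hTτ t ht] with k hk
    exact (hy (φ k)).1.mono fun s hs => ⟨hs.1, hs.2.trans_lt hk.2⟩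
  have hbint : ∀ k, ∀ s ∈ Ico 0 (T k), ∀ t ∈ Ico 0 (T k),
      IntervalIntegrable (fun x => S.b x (u k x)) volume s t := by
    intro k s hs t ht
    have h6 := ((hy k).intervalIntegrable' hs ht).sub
      ((hdriftk k s hs).symm.trans (hdriftk k t ht))
    refine h6.congr ?_
    exact fun x _ => by simp [f_eq_drift_add]
  have hWsub : ∀ k, ∀ s ∈ Ico 0 (T k), ∀ t ∈ Ico 0 (T k),
      W k t - W k s = ∫ x in s..t, S.b x (u k x) := by
    intro k s hs t ht
    have h6 : ∫ x in s..t, S.b x (u k x) = (∫ x in s..t, S.f x (y k x) (u k x)) -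
        ∫ x in s..t, S.drift x (y k x) := by
      rw [← intervalIntegral.integral_sub ((hy k).intervalIntegrable' hs ht)
        ((hdriftk k s hs).symm.trans (hdriftk k t ht))]
      exact intervalIntegral.integral_congr fun x _ => by simp [f_eq_drift_add]
    rw [h6, ← (hy k).sub_eq_integral (hT0 k) hs ht,
      ← intervalIntegral.integral_interval_sub_left (hdriftk k t ht) (hdriftk k s hs)]
    simp only [W]
    abel
  obtain ⟨β, hβ0, hβ⟩ := exists_bound_b h2 h4 h5 hM
  have hwlip : LipschitzOnWith β.toNNReal w (Ico 0 M) := by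
    refine LipschitzOnWith.of_dist_le_mul fun s hs t ht => ?_
    rw [dist_comm, dist_comm s, dist_eq_norm, Real.dist_eq, Real.coe_toNNReal β hβ0]
    refine le_of_tendsto ((hWw t ht).sub (hWw s hs)).norm ?_
    filter_upwards [hTτ t ht, hTτ s hs] with k hkt hks
    rw [hWsub _ s hks t hkt]
    refine intervalIntegral.norm_integral_le_of_norm_le_const fun x hx => hβ x ?_ _
    have hx' := uIoc_subset_uIcc hx
    exact ⟨(le_inf hs.1 ht.1).trans hx'.1, hx'.2.trans (sup_le hs.2.le ht.2.le)⟩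
  have hw0 : w 0 = 0 := by
    have hz0 : z 0 = S.y₀ := tendsto_nhds_unique (hz 0 ⟨le_rfl, hM⟩)
      (tendsto_const_nhds.congr fun k => ((hy (φ k)).initial (hT0 _)).symm)
    simp [w, hz0]
  obtain ⟨v, hvint, hvm, hvw, hvσ⟩ := exists_integral_eq_of_lipschitzOnWith hM hwlip hw0
  -- the density of the limit satisfies the inclusion, as `b(t, U)` is closed and convex
  obtain ⟨D, hDc, hD⟩ := TopologicalSpace.exists_countable_dense (EuclideanSpace ℝ (Fin n))
  have hvD : ∀ᵐ t, ∀ e ∈ D, t ∈ Ioo 0 M → inner ℝ e (v t) ≤ S.supp e t := by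
    refine (ae_ball_iff hDc).2 fun e _ => ?_
    have hσ := intervalIntegrable_supp h4 hM hβ e
    refine hvσ e _ hσ fun s hs t ht hst => ?_
    refine le_of_tendsto (tendsto_const_nhds.inner ((hWw t ht).sub (hWw s hs))) ?_
    filter_upwards [hTτ t ht, hTτ s hs] with k hkt hks
    have hb := hbint _ s hks t hkt
    rw [hWsub _ s hks t hkt]
    rw [← innerSL_apply_apply (𝕜 := ℝ), ← (innerSL ℝ e).intervalIntegral_comp_comm hb]
    refine intervalIntegral.integral_mono_on hst
      ((intervalIntegrable_iff_integrableOn_Ioc_of_le hst).2 ((innerSL ℝ e).integrable_comp hb.1))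
      (hσ.mono_set ?_) fun x hx => h4.inner_le_supp e (hs.1.trans hx.1) _
    rw [uIcc_of_le hst, uIcc_of_le hM.le]
    exact Icc_subset_Icc hs.1 ht.2.le
  have hvb : ∀ᵐ t ∂(volume.restrict (Ioo 0 M)), v t ∈ range (S.b t) := by
    rw [ae_restrict_iff' measurableSet_Ioo]
    filter_upwards [hvD] with t ht htM
    exact mem_range_of_forall_inner_le (h4.convex t htM.1.le) (h4.compact t htM.1.le) hD
      fun e he => ht e he htM
  obtain ⟨c, hcm, hcv⟩ := exists_measurable_implicit (μ := volume.restrict (Ioo 0 M)) hU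
    (h := S.b) (v := v) (fun x => (h4.measurable x).mono_measure
      (Measure.restrict_mono_set _ fun s hs => hs.1.le))
    (by
      filter_upwards [ae_restrict_mem measurableSet_Ioo] with t ht
      exact h4.continuous t ht.1.le) hvm.aemeasurable hvb
  refine ⟨z, c, hcm, hzc, fun t ht => ?_⟩
  have ht' : t ∈ Ico 0 M := Ioo_subset_Ico_self ht
  have hzi := intervalIntegrable_drift_comp h2 h3 ht.1.le (hzc.mono (hsub ht'))
  have hae : ∀ᵐ s, s ∈ uIoc 0 t → S.drift s (z s) + v s = S.f s (z s) (c s) := by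
    filter_upwards [(ae_restrict_iff' measurableSet_Ioo).1 hcv] with s hs hst
    rw [uIoc_of_le ht.1.le] at hst
    rw [f_eq_drift_add, hs ⟨hst.1, hst.2.trans_lt ht.2⟩]
  refine ⟨(hzi.add (hvint 0 t)).congr_ae ((ae_restrict_iff' measurableSet_uIoc).2 hae), ?_⟩
  rw [← intervalIntegral.integral_congr_ae hae, intervalIntegral.integral_add hzi (hvint 0 t),
    ← hvw t ht']
  simp only [w]
  abel

end ControlSystem

end BlowupControl

theorem theorem2p2 {n : ℕ} {U : Type*} [MetricSpace U] [TopologicalSpace.SeparableSpace U]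
    [MeasurableSpace U] [BorelSpace U] (hU : AnalyticSet (Set.univ : Set U))
    (S : BlowupControl.ControlSystem n U)
    (h2 : S.P2) (h3 : S.P3) (h4 : S.P4) (h5 : S.P5)
    (had : S.admissibleControls = BlowupControl.ControlSystem.controls U)
    (tstar : ℝ) (htstar : IsLUB S.blowupTimes tstar) :
    ∃ (y : ℝ → EuclideanSpace ℝ (Fin n)) (u : ℝ → U), S.IsOptimalTS (tstar, y, u) := by
  have hne : S.blowupTimes.Nonempty := htstar.nonempty
  obtain ⟨T, -, hT, hTlim, hTmem⟩ := htstar.exists_seq_monotone_tendsto hne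
  choose y u hyu using hTmem
  have hM : 0 < tstar := (hyu 0).1.1.trans_le (hT 0)
  have : Nonempty U := ⟨u 0 0⟩
  obtain ⟨z, v, hv, hz⟩ := BlowupControl.ControlSystem.exists_isSolutionOn_of_tendsto hU h2 h3 h4 h5
    hM (fun k => (hyu k).1.1) hT hTlim (fun k => (hyu k).1.2.2)
  -- the limit control blows up at some time, which is at most `tstar`
  have hvad : v ∈ S.admissibleControls := had ▸ hv.aemeasurable
  obtain ⟨-, T', y', hadm⟩ := hvad
  have hT' : T' ≤ tstar := htstar.1 ⟨y', v, hadm⟩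
  have hT'0 : 0 < T' := hadm.1.1
  rcases hT'.eq_or_lt with rfl | hlt
  · exact ⟨y', v, hadm, htstar⟩
  -- an earlier blowup contradicts uniqueness, since the limit solution is bounded on `[0, T']`
  exfalso
  have hzT' : S.IsSolutionOn T' z v :=
    ⟨hz.1.mono (Ico_subset_Ico_right hT'), fun t ht => hz.2 t ⟨ht.1, ht.2.trans hlt⟩⟩
  have heq := BlowupControl.ControlSystem.IsSolutionOn.eqOn h2 h3 hT'0 hadm.1.2.2 hzT'
  have hmem : Ico 0 tstar ∈ 𝓝 T' := Ico_mem_nhds hT'0 hlt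
  have hzlim : Tendsto (fun t => ‖z t‖) (𝓝[<] T') (𝓝 ‖z T'‖) :=
    ((hz.1.continuousAt hmem).norm.tendsto).mono_left nhdsWithin_le_nhds
  refine not_tendsto_nhds_of_tendsto_atTop (hadm.2.congr' ?_) _ hzlim
  filter_upwards [Ioo_mem_nhdsLT hT'0] with t ht
  exact congrArg norm (heq (Ioo_subset_Ico_self ht))
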